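/- Let $M$ be a compact connected smooth manifold without boundary, of dimension $d$, with a smooth Riemannian metric and a distance $\mathrm{dist}$ inducing its topology, and let $f\in\mathrm{Diff}^1(M)$. Write $\mathrm{Per}(f)$ for the set of periodic points of $f$ and $$\Omega(f)=\Big\{x:\ U\cap\bigcup_{k>0}f^k(U)\neq\emptyset\ \text{for every neighbourhood } U \text{ of } x\Big\}$$ for its nonwandering set. For $p\in M$ let $W^s(p)=\{x:\mathrm{dist}(f^n(x),f^n(p))\to0 \text{ as } n\to+\infty\}$, and for an orbit $\mathcal O$ let $W^s(\mathcal O)=\bigcup_{q\in\mathcal O}W^s(q)$. A periodic point $p$ of (minimal) period $m$ is hyperbolic if $Df^m(p)$ has no complex eigenvalue of modulus $1$; then $W^s(\mathcal O)$, for $\mathcal O$ the orbit of $p$, is an immersed $C^1$ submanifold. Absolute values of determinants are computed in orthonormal bases. Assume that $f$ has the following properties. 1. All periodic points of $f$ are hyperbolic, and they have distinct eigenvalues: if $p,q$ are periodic points with periods $m,n$ and distinct orbits, then $Df^m(p)$ and $Df^n(q)$ have no common complex eigenvalue. 2. Every connected component $O$ of the interior of $\Omega(f)$ contains a periodic point $p$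 whose stable manifold is dense in $O$, i.e. $O\subset\overline{W^s(p)}$. 3. (Unbounded distortion on the wandering set.) There is a dense subset $\mathcal X$ of $M\setminus\Omega(f)$ such that for all $K>0$, $x\in\mathcal X$ and $y\in M\setminus\Omega(f)$ not in the orbit of $x$, there is $n\ge1$ with $$\big|\log|\det Df^n(x)|-\log|\det Df^n(y)|\big|>K .$$ 4. (Unbounded distortion on stable manifolds.) For every hyperbolic periodic orbit $\mathcal O$ there is a subset $\mathcal X\subset W^s(\mathcal O)$, dense in $W^s(\mathcal O)$ for the topology of $M$, such that for all $K>0$, $x\in\mathcal X$ and $y\in W^s(\mathcal O)$ not in the orbit of $x$, there is $n\ge1$ with $$\big|\log|\det Df^n|_{W^s(\mathcal O)}(x)|-\log|\det Df^n|_{W^s(\mathcal O)}(y)|\big|>K .$$ Here $Df^n|_{W^s(\mathcal O)}(x)$ is the restriction of $Df^n(x)$ to $T_xW^s(\mathcal O)$. 5. (Large derivative on $M\setminus\mathrm{Per}(f)$.) For every $K>0$ there is an integer $n(K)\ge1$ such that for all $x\in M\setminus\mathrm{Per}(f)$ and $n\ge n(K)$ there is $j\in\mathbb Z$ with $$\max\{\|Df^n(f^j(x))\|,\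 \|Df^{-n}(f^{j+n}(x))\|\}>K .$$ Then $f$ has trivial centralizer in $\mathrm{Diff}^1(M)$: $$Z^1(f)=\{g\in\mathrm{Diff}^1(M): fg=gf\}=\{f^k:k\in\mathbb Z\}.$$ -/

import Mathlib

open Set Filter Topology Bundle
open scoped Manifold ContDiff Bundle

noncomputable section

namespace TrivialCentralizer

/-! ### The group of `C^n` diffeomorphisms, and the notion of trivial centralizer -/

section Group

variable {E : Type*} [NormedAddCommGroup E] [NormedSpace ℝ E]
  {H : Type*} [TopologicalSpace H] {I : ModelWithCorners ℝ E H}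
  {M : Type*} [TopologicalSpace M] [ChartedSpace H M] {r : WithTop ℕ∞}

/-- The `C^r` diffeomorphisms of `M` form a group under composition: `(f * g) x = f (g x)`. -/
instance diffGroup : Group (M ≃ₘ^r⟮I, I⟯ M) where
  mul f g := g.trans f
  one := Diffeomorph.refl I M r
  inv f := f.symm
  mul_assoc _ _ _ := rfl
  one_mul _ := rfl
  mul_one _ := rfl
  inv_mul_cancel f := Diffeomorph.ext fun x => f.symm_apply_apply x

theorem diff_mul_apply (f g : M ≃ₘ^r⟮I, I⟯ M) (x : M) : (f * g) x = f (g x) := rfl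

theorem diff_one_apply (x : M) : (1 : M ≃ₘ^r⟮I, I⟯ M) x = x := rfl

theorem diff_inv_apply (f : M ≃ₘ^r⟮I, I⟯ M) (x : M) : f⁻¹ x = f.symm x := rfl

theorem diff_pow_apply (f : M ≃ₘ^r⟮I, I⟯ M) (n : ℕ) (x : M) : (f ^ n) x = f^[n] x := by
  induction n generalizing x with
  | zero => rfl
  | succ n ih => rw [pow_succ, diff_mul_apply, ih, Function.iterate_succ_apply]

end Group

/-! ### Dynamical notions

Throughout, `M` is a manifold of dimension `d` modelled on `ℝ^d` (so without boundary),
`dist` is a distance inducing the topology of `M`, and the tangent bundle of `M` carries a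
Riemannian metric. On a compact manifold none of the notions below depends on the choice of the
distance or of the Riemannian metric. -/

/-- The group `Diff^1(M)`. -/
abbrev Diff1 (d : ℕ) (M : Type*) [TopologicalSpace M]
    [ChartedSpace (EuclideanSpace ℝ (Fin d)) M] : Type _ :=
  M ≃ₘ^1⟮𝓡 d, 𝓡 d⟯ M

section Topological

variable {d : ℕ} {M : Type*} [TopologicalSpace M] [ChartedSpace (EuclideanSpace ℝ (Fin d)) M]

/-- The full orbit `{f^k(x) : k ∈ ℤ}`. -/
def orbit (f : Diff1 d M) (x : M) : Set M := Set.range fun k : ℤ => (f ^ k) x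

/-- The nonwandering set: `x ∈ Ω(f)` iff every neighbourhood `U` of `x` meets `f^k(U)` for some
`k > 0`. -/
def nonwanderingSet (f : Diff1 d M) : Set M :=
  {x | ∀ U ∈ 𝓝 x, ∃ k : ℕ, 0 < k ∧ (U ∩ (f ^ k) '' U).Nonempty}

/-- `Df^m(p)`, where `m` is the (minimal) period of `p`. For a periodic point, `f^m(p) = p` and
both the source `T_p M` and the target `T_{f^m(p)} M` of the derivative are, by definition, the
model space `ℝ^d`, identified with the tangent space through the preferred chart at `p`. -/
def returnDeriv (f : Diff1 d M) (p : M) :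
    EuclideanSpace ℝ (Fin d) →L[ℝ] EuclideanSpace ℝ (Fin d) :=
  mfderiv (𝓡 d) (𝓡 d) ⇑(f ^ Function.minimalPeriod f p) p

/-- The complex eigenvalues of `Df^m(p)`, where `m` is the period of `p`. -/
def eigenvaluesAt (f : Diff1 d M) (p : M) : Set ℂ :=
  {z | Polynomial.aeval z (returnDeriv f p).toLinearMap.charpoly = 0}

/-- `p` is a hyperbolic periodic point: no eigenvalue of `Df^m(p)` has modulus one. -/
def IsHyperbolicPeriodic (f : Diff1 d M) (p : M) : Prop :=
  p ∈ Function.periodicPts f ∧ ∀ z ∈ eigenvaluesAt f p, ‖z‖ ≠ 1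

/-- Periodic points with distinct orbits have disjoint sets of eigenvalues. -/
def HasDistinctEigenvalues (f : Diff1 d M) : Prop :=
  ∀ p ∈ Function.periodicPts f, ∀ q ∈ Function.periodicPts f,
    orbit f p ≠ orbit f q → Disjoint (eigenvaluesAt f p) (eigenvaluesAt f q)

end Topological

section Stable

variable {d : ℕ} {M : Type*} [MetricSpace M] [ChartedSpace (EuclideanSpace ℝ (Fin d)) M]

/-- The stable manifold `W^s(p) = {x : d(f^n(x), f^n(p)) → 0 as n → +∞}` of a point. -/
def stableManifold (f : Diff1 d M) (p : M) : Set M :=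
  {x | Tendsto (fun n : ℕ => dist ((f ^ n) x) ((f ^ n) p)) atTop (𝓝 0)}

/-- The stable manifold `W^s(𝒪)` of the orbit `𝒪` of `p`: the union of the `W^s(q)`, `q ∈ 𝒪`. -/
def orbitStableManifold (f : Diff1 d M) (p : M) : Set M :=
  ⋃ q ∈ orbit f p, stableManifold f q

/-- The tangent space at `x` of `W^s(𝒪)`, where `𝒪` is the orbit of `p`: it consists of the
velocities at `x` of the `C^1` curves drawn on the immersed submanifold `W^s(𝒪)`. Such a curve is
continuous for the immersed topology of `W^s(𝒪)`, in which `y` is close to `x` when `f^n(y)` is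
close to `f^n(x)` uniformly in `n ≥ 0`. -/
def stableTangentSpace (f : Diff1 d M) (p x : M) : Submodule ℝ (TangentSpace (𝓡 d) x) :=
  Submodule.span ℝ {v | ∃ γ : ℝ → M, ContMDiff 𝓘(ℝ, ℝ) (𝓡 d) 1 γ ∧
    (∀ t, γ t ∈ orbitStableManifold f p) ∧
    (∀ t, TendstoUniformly (fun s (n : ℕ) => (f ^ n) (γ s)) (fun n : ℕ => (f ^ n) (γ t)) (𝓝 t)) ∧
    tangentMap 𝓘(ℝ, ℝ) (𝓡 d) γ ⟨0, (1 : ℝ)⟩ = ⟨x, v⟩}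

/-- Every connected component of the interior of `Ω(f)` contains a periodic point whose stable
manifold is dense in that component. -/
def InteriorComponentsHaveDenseStable (f : Diff1 d M) : Prop :=
  ∀ x ∈ interior (nonwanderingSet f),
    ∃ p ∈ connectedComponentIn (interior (nonwanderingSet f)) x, p ∈ Function.periodicPts f ∧
      connectedComponentIn (interior (nonwanderingSet f)) x ⊆ closure (stableManifold f p)

end Stable

section Riemannian

variable {d : ℕ} {M : Type*} [MetricSpace M] [ChartedSpace (EuclideanSpace ℝ (Fin d)) M]
  [RiemannianBundle (fun x : M => TangentSpace (𝓡 d) x)]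

instance tangentSpaceFiniteDimensional (x : M) :
    FiniteDimensional ℝ (TangentSpace (𝓡 d) x) :=
  inferInstanceAs (FiniteDimensional ℝ (EuclideanSpace ℝ (Fin d)))

/-- `|det Df^n(x)|`, the determinant being computed in orthonormal bases of `T_x M` and of
`T_{f^n(x)} M`. -/
def absDet (f : Diff1 d M) (n : ℕ) (x : M) : ℝ :=
  (mfderiv (𝓡 d) (𝓡 d) ⇑(f ^ n) x).toLinearMap.normDet

/-- `|Det Df^n_{|W^s(𝒪)}(x)|`, where `𝒪` is the orbit of `p`: the absolute value of the determinant
in orthonormal bases of the restriction of `Df^n(x)` to `T_x W^s(𝒪)`, as a map onto its image. -/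
def absDetStable (f : Diff1 d M) (p : M) (n : ℕ) (x : M) : ℝ :=
  ((mfderiv (𝓡 d) (𝓡 d) ⇑(f ^ n) x).toLinearMap ∘ₗ (stableTangentSpace f p x).subtype).normDet

/-- The unbounded distortion property on the wandering set. -/
def UDWandering (f : Diff1 d M) : Prop :=
  ∃ X ⊆ (nonwanderingSet f)ᶜ, (nonwanderingSet f)ᶜ ⊆ closure X ∧
    ∀ K > (0 : ℝ), ∀ x ∈ X, ∀ y ∈ (nonwanderingSet f)ᶜ, y ∉ orbit f x →
      ∃ n : ℕ, 1 ≤ n ∧ K < |Real.log (absDet f n x) - Real.log (absDet f n y)|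

/-- The unbounded distortion property on the stable manifolds. Density of `X` in `W^s(𝒪)` is meant
for the topology of `M`; it is implied by density for the immersed topology. -/
def UDStable (f : Diff1 d M) : Prop :=
  ∀ p, IsHyperbolicPeriodic f p →
    ∃ X ⊆ orbitStableManifold f p, orbitStableManifold f p ⊆ closure X ∧
      ∀ K > (0 : ℝ), ∀ x ∈ X, ∀ y ∈ orbitStableManifold f p, y ∉ orbit f x →
        ∃ n : ℕ, 1 ≤ n ∧
          K < |Real.log (absDetStable f p n x) - Real.log (absDetStable f p n y)|

/-- The large derivative property on a set `X`. -/
def LargeDerivativeOn (f : Diff1 d M) (X : Set M) : Prop :=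
  ∀ K > (0 : ℝ), ∃ N : ℕ, 1 ≤ N ∧ ∀ x ∈ X, ∀ n : ℕ, N ≤ n → ∃ j : ℤ,
    K < max ‖mfderiv (𝓡 d) (𝓡 d) ⇑(f ^ n) ((f ^ j) x)‖
      ‖mfderiv (𝓡 d) (𝓡 d) ⇑(f ^ (-(n : ℤ))) ((f ^ (j + n)) x)‖

end Riemannian

end TrivialCentralizer

end

/-! Let `g` commute with `f`, and let `P k` be the closed set where `g = f ^ k`. It suffices that
finitely many of the sets `closure (interior (P k))` cover `M` and that these sets are pairwise
disjoint: connectedness then leaves only one.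

Density. The chain rule for `g ∘ f ^ n = f ^ n ∘ g` bounds, uniformly in `n`, the difference of `log
|det Df^n|` at `x` and at `g x`. The same holds along the stable manifold of a periodic orbit
preserved by `g`; every periodic orbit is preserved, since `Dg` conjugates return derivatives and
distinct orbits share no eigenvalue. Unbounded distortion then forces `g x` into the orbit of `x`,
for a dense set of `x` in the wandering set or in the stable manifold. At wandering points the
exponent is locally constant, because small neighbourhoods never return
(`UDWandering.exists_interior_inter`). On a stable manifold only finitely many exponents occur:
coincidences accumulating at `p` make `Dg` and `Df^k` agree on a nonzero vector at `p`, which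
hyperbolicity allows for finitely many `k` only (`UDStable.closure_subset`). Hence the interiors of
the `P k` have dense union.

Finiteness. On `interior (P k)` the derivative of `f ^ k` is that of `g`, which is bounded, so large
derivative bounds `|k|` (`LargeDerivativeOn.exists_bound`).

Disjointness. At a common point of two closures, `Df^k = Dg = Df^l` by continuity, so `f ^ (k - l)`
would fix that point with identity derivative, against hyperbolicity. -/

noncomputable section

namespace TrivialCentralizer

/-! ### Eigenvalues of commuting real automorphisms -/

section LinearAlgebra

open Module TensorProduct

variable {V : Type*} [AddCommGroup V] [Module ℝ V] [FiniteDimensional ℝ V]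

theorem ker_baseChange_ne_bot {A : End ℝ V} {v : V} (hv : v ≠ 0) (h : A v = 0) :
    LinearMap.ker (A.baseChange ℂ) ≠ ⊥ := by
  rw [← LinearMap.det_eq_zero_iff_ker_ne_bot, LinearMap.det_baseChange,
    LinearMap.det_eq_zero_iff_ker_ne_bot.2, map_zero]
  exact fun hb => hv (LinearMap.ker_eq_bot'.1 hb v h)

theorem units_zpow_apply_eigenvector {W : Type*} [AddCommGroup W] [Module ℂ W] (a : (End ℂ W)ˣ)
    {z : ℂ} {w : W} (hz : z ≠ 0) (h : (a : End ℂ W) w = z • w) (k : ℤ) :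
    ((a ^ k : (End ℂ W)ˣ) : End ℂ W) w = z ^ k • w := by
  have hinv : ((a⁻¹ : (End ℂ W)ˣ) : End ℂ W) w = z⁻¹ • w := by
    have h1 : ((a⁻¹ : (End ℂ W)ˣ) : End ℂ W) ((a : End ℂ W) w) = w := by
      rw [← Module.End.mul_apply, Units.inv_mul, Module.End.one_apply]
    rw [h, map_smul] at h1
    conv_rhs => rw [← h1]
    rw [smul_smul, inv_mul_cancel₀ hz, one_smul]
  induction k with
  | zero => simp
  | succ n ih =>
    rw [zpow_add_one, Units.val_mul, Module.End.mul_apply, h, map_smul, ih, smul_smul,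
      zpow_add_one₀ hz, mul_comm]
  | pred n ih =>
    rw [zpow_sub_one, Units.val_mul, Module.End.mul_apply, hinv, map_smul, ih, smul_smul,
      zpow_sub_one₀ hz, mul_comm]

/-- If `a ^ k` and `b` agree at a nonzero vector, where `a` and `b` commute, then some complex
eigenvalue `z` of `a` has the property that `z ^ k` is an eigenvalue of `b`. -/
theorem exists_eigenvalue_zpow {a b : (End ℝ V)ˣ} (hab : Commute a b) {k : ℤ} {v : V}
    (hv : v ≠ 0) (h : ((a ^ k : (End ℝ V)ˣ) : End ℝ V) v = (b : End ℝ V) v) :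
    ∃ z : ℂ, z ≠ 0 ∧ Polynomial.aeval z (a : End ℝ V).charpoly = 0 ∧
      End.HasEigenvalue ((b : End ℝ V).baseChange ℂ) (z ^ k) := by
  let Φ : (End ℝ V)ˣ →* (End ℂ (ℂ ⊗[ℝ] V))ˣ :=
    Units.map (Module.End.baseChangeHom ℝ ℂ V : End ℝ V →* End ℂ (ℂ ⊗[ℝ] V))
  have hΦ (c : (End ℝ V)ˣ) : (Φ c : End ℂ (ℂ ⊗[ℝ] V)) = (c : End ℝ V).baseChange ℂ := rfl
  have hker : LinearMap.ker ((Φ (a ^ k) : End ℂ (ℂ ⊗[ℝ] V)) - (Φ b : End ℂ (ℂ ⊗[ℝ] V))) ≠ ⊥ := by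
    rw [hΦ, hΦ, ← LinearMap.baseChange_sub]
    exact ker_baseChange_ne_bot hv (by simp [h])
  -- After complexification, the kernel of `a ^ k - b` is nonzero and stable under `a`, so it
  -- contains an eigenvector of `a`, on which `b` acts as `z ^ k`.
  set S := LinearMap.ker ((Φ (a ^ k) : End ℂ (ℂ ⊗[ℝ] V)) - (Φ b : End ℂ (ℂ ⊗[ℝ] V))) with hS
  have hcomm : Commute (Φ a : End ℂ (ℂ ⊗[ℝ] V)) ((Φ (a ^ k) : End ℂ (ℂ ⊗[ℝ] V)) - (Φ b : End ℂ (ℂ ⊗[ℝ] V))) := by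
    have h1 : Commute (Φ a) (Φ (a ^ k)) := ((Commute.refl a).zpow_right k).map Φ
    have h2 : Commute (Φ a) (Φ b) := hab.map Φ
    exact h1.units_val.sub_right h2.units_val
  have hmaps : ∀ w ∈ S, (Φ a : End ℂ (ℂ ⊗[ℝ] V)) w ∈ S := by
    intro w hw
    rw [hS, LinearMap.mem_ker] at hw ⊢
    rw [← Module.End.mul_apply, ← hcomm.eq, Module.End.mul_apply, hw, map_zero]
  have : Nontrivial S := Submodule.nontrivial_iff_ne_bot.2 hker
  obtain ⟨z, hz⟩ := Module.End.exists_eigenvalue ((Φ a : End ℂ (ℂ ⊗[ℝ] V)).restrict hmaps)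
  obtain ⟨w, hw⟩ := hz.exists_hasEigenvector
  have hw0 : (w : ℂ ⊗[ℝ] V) ≠ 0 := fun h0 => hw.2 (Subtype.ext h0)
  have hwz : (Φ a : End ℂ (ℂ ⊗[ℝ] V)) w = z • (w : ℂ ⊗[ℝ] V) :=
    congrArg Subtype.val hw.apply_eq_smul
  have hz0 : z ≠ 0 := by
    rintro rfl
    have h1 : ((Φ a)⁻¹ : (End ℂ (ℂ ⊗[ℝ] V))ˣ).val ((Φ a : End ℂ (ℂ ⊗[ℝ] V)) w) = w := by
      rw [← Module.End.mul_apply, Units.inv_mul, Module.End.one_apply]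
    rw [hwz, zero_smul, map_zero] at h1
    exact hw0 h1.symm
  refine ⟨z, hz0, ?_, ?_⟩
  · have he : End.HasEigenvalue ((a : End ℝ V).baseChange ℂ) z :=
      End.hasEigenvalue_of_hasEigenvector ⟨Module.End.mem_eigenspace_iff.2 hwz, hw0⟩
    have hr := Module.End.hasEigenvalue_iff_isRoot_charpoly _ _ |>.1 he
    rw [LinearMap.charpoly_baseChange] at hr
    rwa [Polynomial.aeval_def, ← Polynomial.eval_map]
  · refine End.hasEigenvalue_of_hasEigenvector ⟨Module.End.mem_eigenspace_iff.2 ?_, hw0⟩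
    have hwS : ((Φ (a ^ k) : End ℂ (ℂ ⊗[ℝ] V)) - (Φ b : End ℂ (ℂ ⊗[ℝ] V))) w = 0 := w.2
    rw [LinearMap.sub_apply, sub_eq_zero] at hwS
    rw [← hΦ, ← hwS, map_zpow]
    exact units_zpow_apply_eigenvector _ hz0 hwz k

/-- Taking `b = 1` above, a fixed vector would produce an eigenvalue with `z ^ k = 1`, hence of
modulus one. -/
theorem zpow_apply_ne_of_hyperbolic {a : (End ℝ V)ˣ}
    (ha : ∀ z : ℂ, Polynomial.aeval z (a : End ℝ V).charpoly = 0 → ‖z‖ ≠ 1) {k : ℤ} (hk : k ≠ 0)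
    {v : V} (hv : v ≠ 0) : ((a ^ k : (End ℝ V)ˣ) : End ℝ V) v ≠ v := by
  intro h
  obtain ⟨z, hz0, hz, he⟩ := exists_eigenvalue_zpow (Commute.one_right a) (k := k) hv (by simpa)
  obtain ⟨w, hw⟩ := he.exists_hasEigenvector
  have h1 := hw.apply_eq_smul
  have h2 : w = z ^ k • w := by
    simpa [Module.End.one_eq_id] using h1
  have h3 : z ^ k = 1 := by
    have : (z ^ k - 1) • w = 0 := by rw [sub_smul, one_smul, ← h2, sub_self]
    exact sub_eq_zero.1 ((smul_eq_zero.1 this).resolve_right hw.2)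
  have h4 : ‖z‖ ^ k = 1 := by rw [← norm_zpow, h3, norm_one]
  exact hk ((zpow_eq_one_iff_right₀ (norm_nonneg z) (ha z hz)).1 h4)

/-- Each such `k` yields a pair `(z, z ^ k)` in a finite product of spectra, and the pair determines
`k` because `‖z‖ ≠ 1`. -/
theorem finite_setOf_zpow_apply_eq {a b : (End ℝ V)ˣ} (hab : Commute a b)
    (ha : ∀ z : ℂ, Polynomial.aeval z (a : End ℝ V).charpoly = 0 → ‖z‖ ≠ 1) :
    {k : ℤ | ∃ v ≠ 0, ((a ^ k : (End ℝ V)ˣ) : End ℝ V) v = (b : End ℝ V) v}.Finite := by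
  have hA : {z : ℂ | Polynomial.aeval z (a : End ℝ V).charpoly = 0}.Finite := by
    have := ((a : End ℝ V).charpoly.map (algebraMap ℝ ℂ)).rootSet_finite ℂ
    refine this.subset fun z hz => ?_
    rw [Polynomial.mem_rootSet]
    refine ⟨((LinearMap.charpoly_monic _).map _).ne_zero, ?_⟩
    simpa using hz
  have hB : {z : ℂ | End.HasEigenvalue ((b : End ℝ V).baseChange ℂ) z}.Finite :=
    Module.End.finite_hasEigenvalue _
  refine ((hA.prod hB).biUnion (t := fun q => {k : ℤ | q.1 ≠ 0 ∧ ‖q.1‖ ≠ 1 ∧ q.1 ^ k = q.2})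
    fun q _ => ?_).subset ?_
  · refine Set.Subsingleton.finite fun k hk l hl => ?_
    have h : ‖q.1‖ ^ k = ‖q.1‖ ^ l := by rw [← norm_zpow, ← norm_zpow, hk.2.2, hl.2.2]
    exact zpow_right_injective₀ (norm_pos_iff.2 hk.1) hk.2.1 h
  · rintro k ⟨v, hv, h⟩
    obtain ⟨z, hz0, hz, he⟩ := exists_eigenvalue_zpow hab hv h
    exact mem_biUnion (x := (z, z ^ k)) ⟨hz, he⟩ ⟨hz0, ha z hz, rfl⟩

end LinearAlgebra

/-! ### Determinants of maps with bounded distortion -/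

section NormDet

open Module

variable {U V : Type*} [NormedAddCommGroup U] [InnerProductSpace ℝ U] [FiniteDimensional ℝ U]
  [NormedAddCommGroup V] [InnerProductSpace ℝ V]

/-- An upper bound for the determinant of a map of norm at most `C` in dimension at most `d`. -/
def detBound (d : ℕ) (C : ℝ) : ℝ := (d.factorial : ℝ) * C ^ d

theorem normDet_le_detBound (L : U →ₗ[ℝ] V) {C : ℝ} (hC : 1 ≤ C) (hL : ∀ u, ‖L u‖ ≤ C * ‖u‖)
    {d : ℕ} (hd : finrank ℝ U ≤ d) : L.normDet ≤ detBound d C := by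
  unfold LinearMap.normDet detBound
  split
  case isTrue h =>
    have hentry : ∀ i j, AbsoluteValue.abs
        (L.rangeRestrict.toMatrix (stdOrthonormalBasis ℝ U).toBasis h.some.toBasis i j) ≤ C := by
      intro i j
      rw [LinearMap.toMatrix_apply]
      simp only [OrthonormalBasis.coe_toBasis, OrthonormalBasis.coe_toBasis_repr_apply,
        AbsoluteValue.abs_apply]
      rw [OrthonormalBasis.repr_apply_apply]
      refine (abs_real_inner_le_norm _ _).trans ?_
      rw [OrthonormalBasis.norm_eq_one, one_mul]
      refine (hL _).trans ?_
      rw [OrthonormalBasis.norm_eq_one, mul_one]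
    have h1 := Matrix.det_le hentry
    rw [AbsoluteValue.abs_apply, Fintype.card_fin, nsmul_eq_mul] at h1
    rw [Real.norm_eq_abs]
    refine h1.trans ?_
    -- Here `1 ≤ C` allows the exponent in the Leibniz bound to grow from the actual dimension to
    -- `d`.
    gcongr
  case isFalse => positivity

theorem normDet_pos_of_injective {L : U →ₗ[ℝ] V} (hL : Function.Injective L) : 0 < L.normDet := by
  refine lt_of_le_of_ne L.normDet_nonneg fun h => ?_
  exact LinearMap.normDet_eq_zero_iff_ker_ne_bot.1 h.symm (LinearMap.ker_eq_bot.2 hL)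

theorem injective_of_norm_le {U V : Type*} [NormedAddCommGroup U] [NormedSpace ℝ U]
    [NormedAddCommGroup V] [NormedSpace ℝ V] {L : U →ₗ[ℝ] V} {C : ℝ}
    (hL : ∀ u, ‖u‖ ≤ C * ‖L u‖) : Function.Injective L := by
  refine (injective_iff_map_eq_zero L).2 fun u hu => ?_
  have := hL u
  rw [hu, norm_zero, mul_zero] at this
  exact norm_le_zero_iff.1 this

/-- The lower bound on the determinant is the upper bound applied to the inverse of `L` on its
range. -/
theorem abs_log_normDet_le (L : U →ₗ[ℝ] V) {C : ℝ} (hC : 1 ≤ C) (hL : ∀ u, ‖L u‖ ≤ C * ‖u‖)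
    (hL' : ∀ u, ‖u‖ ≤ C * ‖L u‖) {d : ℕ} (hd : finrank ℝ U ≤ d) :
    |Real.log L.normDet| ≤ Real.log (detBound d C) := by
  have hinj : Function.Injective L := injective_of_norm_le hL'
  have hpos := normDet_pos_of_injective hinj
  have hB : 0 < detBound d C := by unfold detBound; positivity
  let e := LinearEquiv.ofInjective L hinj
  have he : ∀ u, ‖e.symm.toLinearMap u‖ ≤ C * ‖u‖ := by
    intro u
    have h := hL' (e.symm u)
    have h2 : L (e.symm u) = u := congrArg Subtype.val (e.apply_symm_apply u)
    rwa [h2] at h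
  have hfin : finrank ℝ L.range = finrank ℝ U := e.symm.finrank_eq
  have h1 := normDet_le_detBound e.symm.toLinearMap hC he (hfin.trans_le hd)
  have h2 : e.symm.toLinearMap.normDet * L.normDet = 1 := by
    have h3 : L.normDet = e.toLinearMap.normDet := by
      have : e.toLinearMap = L.codRestrict L.range (fun c => LinearMap.mem_range_self L c) := rfl
      rw [this, LinearMap.normDet_codRestrict]
    rw [h3, ← LinearMap.normDet_comp_of_finrank_eq _ _ hfin.symm]
    simp
  rw [abs_le]
  constructor
  · rw [neg_le, ← Real.log_inv]
    refine Real.log_le_log (inv_pos.2 hpos) ?_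
    rwa [← eq_inv_of_mul_eq_one_left h2]
  · exact Real.log_le_log hpos (normDet_le_detBound L hC hL hd)

/-- Maps which are conjugate by maps with bounded distortion have comparable determinants. -/
theorem abs_log_normDet_sub_le {U₁ U₂ V₁ V₂ W : Type*}
    [NormedAddCommGroup U₁] [InnerProductSpace ℝ U₁] [FiniteDimensional ℝ U₁]
    [NormedAddCommGroup U₂] [InnerProductSpace ℝ U₂] [FiniteDimensional ℝ U₂]
    [NormedAddCommGroup V₁] [InnerProductSpace ℝ V₁] [NormedAddCommGroup V₂]
    [InnerProductSpace ℝ V₂] [NormedAddCommGroup W] [InnerProductSpace ℝ W]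
    {A₁ : U₁ →ₗ[ℝ] V₁} {A₂ : U₂ →ₗ[ℝ] W} {G : U₁ →ₗ[ℝ] U₂}
    {H : V₁ →ₗ[ℝ] V₂} {C : ℝ} (hC : 1 ≤ C) (hG : ∀ u, ‖G u‖ ≤ C * ‖u‖)
    (hG' : ∀ u, ‖u‖ ≤ C * ‖G u‖) (hH : ∀ u, ‖H u‖ ≤ C * ‖u‖) (hH' : ∀ u, ‖u‖ ≤ C * ‖H u‖)
    (hA₁ : Function.Injective A₁) (hA₂ : Function.Injective A₂)
    (hdim : finrank ℝ U₁ = finrank ℝ U₂) {d : ℕ} (hd : finrank ℝ U₁ ≤ d)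
    (h : (H ∘ₗ A₁).normDet = (A₂ ∘ₗ G).normDet) :
    |Real.log A₁.normDet - Real.log A₂.normDet| ≤ 2 * Real.log (detBound d C) := by
  have hfin : finrank ℝ A₁.range = finrank ℝ U₁ := LinearMap.finrank_range_of_inj hA₁
  have h1 := abs_log_normDet_le G hC hG hG' hd
  have h2 := abs_log_normDet_le (H.domRestrict A₁.range) hC (fun u => hH u) (fun u => hH' u)
    (hfin.trans_le hd)
  have p1 := normDet_pos_of_injective (injective_of_norm_le hG')
  have p2 := normDet_pos_of_injective (injective_of_norm_le
    (L := H.domRestrict A₁.range) fun u => hH' u)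
  -- `H` enters only through its restriction to the range of `A₁`, which may be a proper subspace,
  -- as for stable tangent spaces.
  rw [LinearMap.normDet_comp, LinearMap.normDet_comp_of_finrank_eq _ _ hdim] at h
  have h3 := congrArg Real.log h
  rw [Real.log_mul p2.ne' (normDet_pos_of_injective hA₁).ne',
    Real.log_mul (normDet_pos_of_injective hA₂).ne' p1.ne'] at h3
  have h4 : Real.log A₁.normDet - Real.log A₂.normDet
      = Real.log G.normDet - Real.log (H.domRestrict A₁.range).normDet := by linarith
  rw [h4]
  refine (abs_sub _ _).trans ?_
  linarith

end NormDet

/-! ### Derivatives of diffeomorphisms and coincidence sets -/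

section Derivative

variable {d : ℕ} {M : Type*} [TopologicalSpace M] [ChartedSpace (EuclideanSpace ℝ (Fin d)) M]

/-- The derivative of a diffeomorphism, as an endomorphism of the model space. -/
def derivAt (φ : Diff1 d M) (x : M) :
    EuclideanSpace ℝ (Fin d) →L[ℝ] EuclideanSpace ℝ (Fin d) :=
  mfderiv (𝓡 d) (𝓡 d) ⇑φ x

theorem mdifferentiableAt_diff (φ : Diff1 d M) (x : M) : MDifferentiableAt (𝓡 d) (𝓡 d) φ x :=
  φ.contMDiff.mdifferentiable one_ne_zero x

theorem inv_apply_self (φ : Diff1 d M) (x : M) : φ⁻¹ (φ x) = x := φ.symm_apply_apply x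

theorem apply_inv_self (φ : Diff1 d M) (x : M) : φ (φ⁻¹ x) = x := φ.apply_symm_apply x

theorem derivAt_mul (φ ψ : Diff1 d M) (x : M) :
    derivAt (φ * ψ) x = derivAt φ (ψ x) ∘L derivAt ψ x :=
  mfderiv_comp x (mdifferentiableAt_diff φ (ψ x)) (mdifferentiableAt_diff ψ x)

theorem derivAt_one (x : M) : derivAt (1 : Diff1 d M) x = ContinuousLinearMap.id ℝ _ :=
  mfderiv_id

theorem derivAt_eq_of_eventuallyEq {φ ψ : Diff1 d M} {x : M} (h : ⇑φ =ᶠ[𝓝 x] ψ) :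
    derivAt φ x = derivAt ψ x :=
  h.mfderiv_eq

/-- The diffeomorphisms which fix the point `p`. -/
def fixer (p : M) : Subgroup (Diff1 d M) where
  carrier := {φ | φ p = p}
  mul_mem' {φ ψ} hφ hψ := by
    change φ (ψ p) = p
    rw [show ψ p = p from hψ, show φ p = p from hφ]
  one_mem' := rfl
  inv_mem' {φ} hφ := by
    change φ⁻¹ p = p
    conv_lhs => rw [← show φ p = p from hφ]
    exact inv_apply_self φ p

/-- The derivative at `p`, as a representation of the diffeomorphisms which fix `p`. -/
def fixerDeriv (p : M) : fixer (d := d) p →* Module.End ℝ (EuclideanSpace ℝ (Fin d)) where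
  toFun φ := (derivAt (φ : Diff1 d M) p).toLinearMap
  map_one' := by
    rw [OneMemClass.coe_one, derivAt_one]
    rfl
  map_mul' φ ψ := by
    rw [Subgroup.coe_mul, derivAt_mul, show (ψ : Diff1 d M) p = p from ψ.2]
    rfl

theorem toHomUnits_fixerDeriv_apply {p : M} (φ : fixer (d := d) p) (v : EuclideanSpace ℝ (Fin d)) :
    ((fixerDeriv p).toHomUnits φ : Module.End ℝ (EuclideanSpace ℝ (Fin d))) v
      = derivAt (φ : Diff1 d M) p v := rfl

theorem derivAt_injective (φ : Diff1 d M) (x : M) : Function.Injective (derivAt φ x) := by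
  have h : derivAt φ⁻¹ (φ x) ∘L derivAt φ x = ContinuousLinearMap.id ℝ _ := by
    rw [← derivAt_mul, inv_mul_cancel, derivAt_one]
  exact Function.LeftInverse.injective (g := derivAt φ⁻¹ (φ x)) fun v => DFunLike.congr_fun h v

/-- If two maps agree on a set which accumulates at `p`, then their derivatives at `p` agree at some
nonzero vector. -/
theorem exists_derivAt_apply_eq {φ ψ : Diff1 d M} {p : M} (hp : φ p = ψ p)
    (h : ∃ᶠ x in 𝓝[≠] p, φ x = ψ x) : ∃ v ≠ 0, derivAt φ p v = derivAt ψ p v := by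
  by_contra! hne
  set e := extChartAt (𝓡 d) p with he
  have hφ := (mdifferentiableAt_diff φ p).hasMFDerivAt.2
  have hψ := (mdifferentiableAt_diff ψ p).hasMFDerivAt.2
  simp only [modelWithCornersSelf_coe, range_id] at hφ hψ
  have hsub : HasFDerivAt (fun y => writtenInExtChartAt (𝓡 d) (𝓡 d) p φ y
      - writtenInExtChartAt (𝓡 d) (𝓡 d) p ψ y) (derivAt φ p - derivAt ψ p) (e p) :=
    HasFDerivAt.sub (hasFDerivWithinAt_univ.1 hφ) (hasFDerivWithinAt_univ.1 hψ)
  -- An injective derivative in finite dimension is bounded below, so the difference of the two maps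
  -- in charts would have an isolated zero at `p`.
  have hinj : LinearMap.ker (derivAt φ p - derivAt ψ p).toLinearMap = ⊥ := by
    refine LinearMap.ker_eq_bot'.2 fun v hv => ?_
    by_contra hv0
    exact hne v hv0 (sub_eq_zero.1 hv)
  obtain ⟨K, -, hK⟩ := LinearMap.exists_antilipschitzWith _ hinj
  have hev := hsub.eventually_ne (c := 0) ⟨K, hK⟩
  have htend : Tendsto e (𝓝[≠] p) (𝓝[≠] (e p)) := by
    refine tendsto_nhdsWithin_iff.2 ⟨(continuousAt_extChartAt p).tendsto.mono_left
      nhdsWithin_le_nhds, ?_⟩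
    filter_upwards [self_mem_nhdsWithin,
      mem_nhdsWithin_of_mem_nhds (extChartAt_source_mem_nhds (I := 𝓡 d) p)] with x hx hxs hxe
    exact hx (e.injOn hxs (mem_extChartAt_source p) hxe)
  refine h ?_
  filter_upwards [htend.eventually hev,
    mem_nhdsWithin_of_mem_nhds (extChartAt_source_mem_nhds (I := 𝓡 d) p)] with x hx hxs hxe
  apply hx
  rw [sub_eq_zero]
  simp only [writtenInExtChartAt, Function.comp_apply, ← he, e.left_inv hxs, hxe, hp]

variable [IsManifold (𝓡 d) 1 M]

theorem continuousAt_inTangentCoordinates_derivAt (φ : Diff1 d M) (p : M) :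
    ContinuousAt (inTangentCoordinates (𝓡 d) (𝓡 d) id φ (derivAt φ) p) p :=
  (ContMDiffAt.mfderiv_const (m := 0) φ.contMDiff.contMDiffAt (by simp)).continuousAt

/-- The expression of the derivative in the trivializations of the tangent bundle. -/
theorem derivAt_eq_symmL_inTangentCoordinates (φ : Diff1 d M) {p x : M}
    (hx : x ∈ (trivializationAt (EuclideanSpace ℝ (Fin d)) (TangentSpace (𝓡 d)) p).baseSet)
    (hφx : φ x ∈ (trivializationAt (EuclideanSpace ℝ (Fin d))
      (TangentSpace (𝓡 d)) (φ p)).baseSet) (v : TangentSpace (𝓡 d) x) :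
    derivAt φ x v = (trivializationAt (EuclideanSpace ℝ (Fin d)) (TangentSpace (𝓡 d))
      (φ p)).symmL ℝ (φ x) (inTangentCoordinates (𝓡 d) (𝓡 d) id φ (derivAt φ) p x
        ((trivializationAt (EuclideanSpace ℝ (Fin d)) (TangentSpace (𝓡 d)) p).continuousLinearMapAt
          ℝ x v)) := by
  have h1 := Trivialization.symmL_continuousLinearMapAt (R := ℝ) _ hx v
  have h2 := Trivialization.symmL_continuousLinearMapAt (R := ℝ) _ hφx (derivAt φ x v)
  conv_lhs => rw [← h2, ← h1]
  rfl

/-- Two diffeomorphisms which agree on an open set have the same derivative on its closure. -/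
theorem derivAt_eq_of_mem_closure [T2Space M] {φ ψ : Diff1 d M} {p : M}
    (h : p ∈ closure (interior {x | φ x = ψ x})) : derivAt φ p = derivAt ψ p := by
  have hp : φ p = ψ p :=
    (isClosed_eq φ.continuous ψ.continuous).closure_subset_iff.2 interior_subset h
  have heq : ∀ x, φ x = ψ x → derivAt φ x = derivAt ψ x →
      inTangentCoordinates (𝓡 d) (𝓡 d) id φ (derivAt φ) p x
        = inTangentCoordinates (𝓡 d) (𝓡 d) id ψ (derivAt ψ) p x := by
    intro x h1 h2
    -- The fibres over `φ x` and `ψ x` agree only through the equality of these points; this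
    -- transports between them.
    have key : ∀ y z : M, y = z → ∀ A : EuclideanSpace ℝ (Fin d) →L[ℝ] EuclideanSpace ℝ (Fin d),
        ContinuousLinearMap.inCoordinates (EuclideanSpace ℝ (Fin d)) (TangentSpace (𝓡 d) (M := M))
          (EuclideanSpace ℝ (Fin d)) (TangentSpace (𝓡 d) (M := M)) p x (ψ p) y A
        = ContinuousLinearMap.inCoordinates (EuclideanSpace ℝ (Fin d))
          (TangentSpace (𝓡 d) (M := M)) (EuclideanSpace ℝ (Fin d))
          (TangentSpace (𝓡 d) (M := M)) p x (ψ p) z A := by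
      rintro y _ rfl A
      rfl
    simp only [inTangentCoordinates, h2, hp]
    exact key _ _ h1 _
  have hfreq : ∃ᶠ x in 𝓝 p, inTangentCoordinates (𝓡 d) (𝓡 d) id φ (derivAt φ) p x
      = inTangentCoordinates (𝓡 d) (𝓡 d) id ψ (derivAt ψ) p x := by
    refine (mem_closure_iff_frequently.1 h).mono fun x hx => ?_
    exact heq x (interior_subset (s := {x | φ x = ψ x}) hx)
      (derivAt_eq_of_eventuallyEq (mem_interior_iff_mem_nhds.1 hx))
  have hlim := tendsto_nhds_unique_of_frequently_eq
    (continuousAt_inTangentCoordinates_derivAt φ p).tendsto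
    (continuousAt_inTangentCoordinates_derivAt ψ p).tendsto hfreq
  ext1 v
  have h1 := derivAt_eq_symmL_inTangentCoordinates φ (p := p) (mem_baseSet_trivializationAt _ _ _)
    (mem_baseSet_trivializationAt _ _ _) v
  have h2 := derivAt_eq_symmL_inTangentCoordinates ψ (p := p) (mem_baseSet_trivializationAt _ _ _)
    (mem_baseSet_trivializationAt _ _ _) v
  rw [hlim, hp] at h1
  exact h1.trans h2.symm

end Derivative

/-! ### Uniform bounds for the derivative -/

section Riemannian

variable {d : ℕ} {M : Type*} [TopologicalSpace M] [ChartedSpace (EuclideanSpace ℝ (Fin d)) M]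
  [RiemannianBundle (fun x : M => TangentSpace (𝓡 d) x)]

/-- The derivative of a `C^1` diffeomorphism of a compact manifold is bounded. -/
theorem exists_norm_mfderiv_apply_le [CompactSpace M] [IsManifold (𝓡 d) 1 M]
    [IsContinuousRiemannianBundle (EuclideanSpace ℝ (Fin d))
      (fun x : M => TangentSpace (𝓡 d) x)] (φ : Diff1 d M) :
    ∃ C : ℝ, 1 ≤ C ∧ ∀ (x : M) (v : TangentSpace (𝓡 d) x),
      ‖mfderiv (𝓡 d) (𝓡 d) φ x v‖ ≤ C * ‖v‖ := by
  have hloc : ∀ p : M, ∃ C : ℝ, ∀ᶠ x in 𝓝 p, ∀ v : TangentSpace (𝓡 d) x,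
      ‖mfderiv (𝓡 d) (𝓡 d) φ x v‖ ≤ C * ‖v‖ := by
    intro p
    obtain ⟨C₁, hC₁, h₁⟩ := eventually_norm_trivializationAt_lt (EuclideanSpace ℝ (Fin d))
      (fun x : M => TangentSpace (𝓡 d) x) p
    obtain ⟨C₂, hC₂, h₂⟩ := eventually_norm_symmL_trivializationAt_lt (EuclideanSpace ℝ (Fin d))
      (fun x : M => TangentSpace (𝓡 d) x) (φ p)
    have h₃ := (continuousAt_inTangentCoordinates_derivAt φ p).norm.eventually_lt_const
      (lt_add_one _)
    set C₃ := ‖inTangentCoordinates (𝓡 d) (𝓡 d) id φ (derivAt φ) p p‖ + 1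
    have hC₃ : 0 < C₃ := by positivity
    have hb₁ := (trivializationAt (EuclideanSpace ℝ (Fin d)) (TangentSpace (𝓡 d))
      p).open_baseSet.mem_nhds (mem_baseSet_trivializationAt _ _ _)
    have hb₂ := φ.continuous.continuousAt.preimage_mem_nhds
      ((trivializationAt (EuclideanSpace ℝ (Fin d)) (TangentSpace (𝓡 d))
        (φ p)).open_baseSet.mem_nhds (mem_baseSet_trivializationAt _ _ _))
    -- The factors bound the trivialization at `p`, the derivative in coordinates, and the inverse
    -- trivialization at `φ p`.
    refine ⟨C₂ * (C₃ * C₁), ?_⟩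
    filter_upwards [h₁, φ.continuous.continuousAt.eventually h₂, h₃, hb₁, hb₂]
      with x hx₁ hx₂ hx₃ hxb₁ hxb₂ v
    have h := derivAt_eq_symmL_inTangentCoordinates φ hxb₁ hxb₂ v
    change ‖(show TangentSpace (𝓡 d) (φ x) from derivAt φ x v)‖ ≤ _
    rw [h]
    refine (ContinuousLinearMap.le_of_opNorm_le _ hx₂.le _).trans ?_
    rw [mul_assoc]
    refine mul_le_mul_of_nonneg_left ?_ hC₂.le
    refine (ContinuousLinearMap.le_of_opNorm_le _ hx₃.le _).trans ?_
    rw [mul_assoc]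
    exact mul_le_mul_of_nonneg_left (ContinuousLinearMap.le_of_opNorm_le _ hx₁.le _) hC₃.le
  choose C hC using hloc
  obtain ⟨t, ht⟩ := (isCompact_univ (X := M)).elim_nhds_subcover _ fun p _ => hC p
  obtain ⟨B, hB⟩ := (t.image C).bddAbove
  refine ⟨max B 1, le_max_right _ _, fun x v => ?_⟩
  obtain ⟨p, hp, hx⟩ := mem_iUnion₂.1 (ht.2 (mem_univ x))
  refine (hx v).trans (mul_le_mul_of_nonneg_right ?_ (norm_nonneg v))
  exact (hB (Finset.mem_coe.2 (Finset.mem_image_of_mem C hp))).trans (le_max_left _ _)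

theorem norm_mfderiv_apply_of_eq_id {φ : M → M} (hφ : φ = id) (x : M)
    (v : TangentSpace (𝓡 d) x) : ‖mfderiv (𝓡 d) (𝓡 d) φ x v‖ = ‖v‖ := by
  subst hφ
  rw [mfderiv_id]
  rfl

/-- A lower bound on the derivative follows from an upper bound on that of the inverse. -/
theorem norm_le_norm_mfderiv_apply {φ : Diff1 d M} {C : ℝ}
    (h : ∀ (x : M) (v : TangentSpace (𝓡 d) x), ‖mfderiv (𝓡 d) (𝓡 d) ⇑φ⁻¹ x v‖ ≤ C * ‖v‖)
    (x : M) (v : TangentSpace (𝓡 d) x) : ‖v‖ ≤ C * ‖mfderiv (𝓡 d) (𝓡 d) φ x v‖ := by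
  have h1 : (⇑φ⁻¹ ∘ ⇑φ) = id := funext (inv_apply_self φ)
  have h2 := h (φ x) (mfderiv (𝓡 d) (𝓡 d) φ x v)
  rw [← norm_mfderiv_apply_of_eq_id h1 x v,
    mfderiv_comp x (mdifferentiableAt_diff φ⁻¹ (φ x)) (mdifferentiableAt_diff φ x)]
  exact h2

theorem norm_mfderiv_eq_of_eventuallyEq {φ ψ : M → M} {x : M} (h : φ =ᶠ[𝓝 x] ψ) :
    ‖mfderiv (𝓡 d) (𝓡 d) φ x‖ = ‖mfderiv (𝓡 d) (𝓡 d) ψ x‖ := by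
  have key : ∀ (y z : M), y = z → ∀ A : EuclideanSpace ℝ (Fin d) →L[ℝ] EuclideanSpace ℝ (Fin d),
      ‖(show TangentSpace (𝓡 d) x →L[ℝ] TangentSpace (𝓡 d) y from A)‖
        = ‖(show TangentSpace (𝓡 d) x →L[ℝ] TangentSpace (𝓡 d) z from A)‖ := by
    rintro y _ rfl A
    rfl
  rw [h.mfderiv_eq]
  exact key _ _ h.self_of_nhds _

theorem norm_mfderiv_le_of_eventuallyEq {φ ψ : Diff1 d M} {C : ℝ} (hC : 1 ≤ C)
    (h : ∀ (x : M) (v : TangentSpace (𝓡 d) x), ‖mfderiv (𝓡 d) (𝓡 d) ψ x v‖ ≤ C * ‖v‖) {y : M}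
    (hy : ⇑φ =ᶠ[𝓝 y] ψ) : ‖mfderiv (𝓡 d) (𝓡 d) φ y‖ ≤ C := by
  rw [norm_mfderiv_eq_of_eventuallyEq hy]
  exact ContinuousLinearMap.opNorm_le_bound _ (zero_le_one.trans hC) (h y)

end Riemannian

/-! ### Periodic orbits, wandering points and the centralizer -/

section Dynamics

variable {d : ℕ} {M : Type*} [TopologicalSpace M] [ChartedSpace (EuclideanSpace ℝ (Fin d)) M]
  {f g : Diff1 d M} {p x : M}

theorem commute_apply (h : Commute f g) (x : M) : f (g x) = g (f x) :=
  DFunLike.congr_fun h.eq x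

theorem zpow_add_apply (f : Diff1 d M) (j k : ℤ) (x : M) : (f ^ (j + k)) x = (f ^ j) ((f ^ k) x) := by
  rw [zpow_add, diff_mul_apply]

theorem zpow_neg_apply_zpow_apply (f : Diff1 d M) (k : ℤ) (x : M) :
    (f ^ (-k)) ((f ^ k) x) = x := by
  rw [zpow_neg, inv_apply_self]

theorem zpow_apply_zpow_neg_apply (f : Diff1 d M) (k : ℤ) (x : M) :
    (f ^ k) ((f ^ (-k)) x) = x := by
  rw [zpow_neg, apply_inv_self]

theorem isPeriodicPt_iff {n : ℕ} : Function.IsPeriodicPt f n x ↔ (f ^ n) x = x := by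
  rw [diff_pow_apply]
  rfl

theorem pow_minimalPeriod_apply (f : Diff1 d M) (p : M) :
    (f ^ Function.minimalPeriod f p) p = p :=
  isPeriodicPt_iff.1 (Function.isPeriodicPt_minimalPeriod f p)

theorem minimalPeriod_dvd_of_zpow_apply {k : ℤ} (h : (f ^ k) p = p) :
    (Function.minimalPeriod f p : ℤ) ∣ k := by
  have key : ∀ n : ℕ, (f ^ n) p = p → Function.minimalPeriod f p ∣ n := fun n hn =>
    (isPeriodicPt_iff.2 hn).minimalPeriod_dvd
  obtain ⟨n, rfl | rfl⟩ := k.eq_nat_or_neg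
  · rw [zpow_natCast] at h
    exact Int.natCast_dvd_natCast.2 (key n h)
  · have h1 := zpow_apply_zpow_neg_apply f n p
    rw [h, zpow_natCast] at h1
    exact (dvd_neg).2 (Int.natCast_dvd_natCast.2 (key n h1))

theorem mem_periodicPts_of_zpow_apply {k : ℤ} (hk : k ≠ 0) (h : (f ^ k) p = p) :
    p ∈ Function.periodicPts f := by
  by_contra hp
  have := minimalPeriod_dvd_of_zpow_apply h
  rw [Function.minimalPeriod_eq_zero_of_notMem_periodicPts hp] at this
  exact hk (zero_dvd_iff.1 (by exact_mod_cast this))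

theorem minimalPeriod_apply_of_commute (h : Commute f g) (x : M) :
    Function.minimalPeriod f (g x) = Function.minimalPeriod f x := by
  refine Function.minimalPeriod_eq_minimalPeriod_iff.2 fun n => ?_
  rw [isPeriodicPt_iff, isPeriodicPt_iff, commute_apply (h.pow_left n)]
  exact g.injective.eq_iff

theorem apply_mem_periodicPts_iff (h : Commute f g) :
    g x ∈ Function.periodicPts f ↔ x ∈ Function.periodicPts f := by
  rw [← Function.minimalPeriod_pos_iff_mem_periodicPts,
    ← Function.minimalPeriod_pos_iff_mem_periodicPts, minimalPeriod_apply_of_commute h]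

/-- The first return map at `p`, as a diffeomorphism which fixes `p`. -/
def returnMap (f : Diff1 d M) (p : M) : fixer (d := d) p :=
  ⟨f ^ Function.minimalPeriod f p, pow_minimalPeriod_apply f p⟩

theorem IsHyperbolicPeriodic.norm_ne_one (hp : IsHyperbolicPeriodic f p) (z : ℂ)
    (hz : Polynomial.aeval z ((fixerDeriv p).toHomUnits (returnMap f p) :
      Module.End ℝ (EuclideanSpace ℝ (Fin d))).charpoly = 0) : ‖z‖ ≠ 1 :=
  hp.2 z hz

theorem coe_returnMap_zpow (f : Diff1 d M) (p : M) (l : ℤ) :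
    ((returnMap f p ^ l : fixer (d := d) p) : Diff1 d M)
      = f ^ ((Function.minimalPeriod f p : ℤ) * l) := by
  rw [Subgroup.coe_zpow, zpow_mul, zpow_natCast]
  rfl

theorem toHomUnits_returnMap_zpow_apply (f : Diff1 d M) (p : M) (l : ℤ)
    (v : EuclideanSpace ℝ (Fin d)) :
    (((fixerDeriv p).toHomUnits (returnMap f p) ^ l : (Module.End ℝ (EuclideanSpace ℝ (Fin d)))ˣ) :
      Module.End ℝ (EuclideanSpace ℝ (Fin d))) v
      = derivAt (f ^ ((Function.minimalPeriod f p : ℤ) * l)) p v := by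
  rw [← map_zpow, toHomUnits_fixerDeriv_apply, coe_returnMap_zpow]

theorem IsHyperbolicPeriodic.derivAt_zpow_apply_ne (hp : IsHyperbolicPeriodic f p) {k : ℤ}
    (hk : k ≠ 0) (h : (f ^ k) p = p) {v : EuclideanSpace ℝ (Fin d)} (hv : v ≠ 0) :
    derivAt (f ^ k) p v ≠ v := by
  obtain ⟨l, rfl⟩ := minimalPeriod_dvd_of_zpow_apply h
  rw [← toHomUnits_returnMap_zpow_apply]
  exact zpow_apply_ne_of_hyperbolic hp.norm_ne_one (right_ne_zero_of_mul hk) hv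

/-- Only finitely many iterates of `f` agree with `g` at a hyperbolic periodic point to first order
in some direction. -/
theorem IsHyperbolicPeriodic.finite_exponents (hp : IsHyperbolicPeriodic f p) (h : Commute f g) :
    {k : ℤ | g p = (f ^ k) p ∧ ∃ v ≠ 0, derivAt g p v = derivAt (f ^ k) p v}.Finite := by
  rcases eq_empty_or_nonempty {k : ℤ | g p = (f ^ k) p ∧ ∃ v ≠ 0, derivAt g p v
    = derivAt (f ^ k) p v} with he | ⟨k₀, hk₀, -⟩
  · rw [he]
    exact finite_empty
  -- Composing with `f ^ (-k₀)` gives a map fixing `p` and commuting with the first return. The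
  -- other exponents differ from `k₀` by multiples of the period, so the linear finiteness result
  -- applies.
  have hfix : (f ^ (-k₀) * g) p = p := by
    rw [diff_mul_apply, hk₀, zpow_neg_apply_zpow_apply]
  let b : fixer (d := d) p := ⟨f ^ (-k₀) * g, hfix⟩
  have hcomm : Commute (returnMap f p) b := Subtype.ext
    (((Commute.refl f).zpow_right (-k₀)).mul_right h |>.pow_left (Function.minimalPeriod f p)).eq
  refine ((finite_setOf_zpow_apply_eq (hcomm.map (fixerDeriv p).toHomUnits) hp.norm_ne_one).image
    fun l => k₀ + (Function.minimalPeriod f p : ℤ) * l).subset ?_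
  rintro k ⟨hk, v, hv, hkv⟩
  have h1 : (f ^ (-k₀ + k)) p = p := by
    rw [zpow_add_apply, ← hk, hk₀, zpow_neg_apply_zpow_apply]
  obtain ⟨l, hl⟩ := minimalPeriod_dvd_of_zpow_apply h1
  refine ⟨l, ⟨v, hv, ?_⟩, by simp only [← hl]; ring⟩
  rw [toHomUnits_returnMap_zpow_apply, toHomUnits_fixerDeriv_apply, ← hl, zpow_add, derivAt_mul,
    derivAt_mul, ← hk, ContinuousLinearMap.comp_apply, ContinuousLinearMap.comp_apply, hkv]

theorem eigenvaluesAt_nonempty [Nontrivial (EuclideanSpace ℝ (Fin d))] (f : Diff1 d M) (p : M) :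
    (eigenvaluesAt f p).Nonempty := by
  have hdeg : ((returnDeriv f p).toLinearMap.charpoly.map (algebraMap ℝ ℂ)).degree ≠ 0 := by
    rw [Polynomial.degree_map, Polynomial.degree_eq_natDegree (LinearMap.charpoly_monic _).ne_zero,
      LinearMap.charpoly_natDegree]
    exact_mod_cast Module.finrank_pos.ne'
  obtain ⟨z, hz⟩ := IsAlgClosed.exists_root _ hdeg
  refine ⟨z, ?_⟩
  rw [Polynomial.IsRoot.def, Polynomial.eval_map] at hz
  exact hz

/-- The derivative of `g` at `p` conjugates the two return derivatives, since `p` and `g p` have the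
same period. -/
theorem eigenvaluesAt_apply_of_commute (h : Commute f g) (p : M) :
    eigenvaluesAt f (g p) = eigenvaluesAt f p := by
  have hB := derivAt_injective g p
  let B := LinearEquiv.ofInjectiveEndo (derivAt g p).toLinearMap hB
  set m := Function.minimalPeriod f p with hm
  have h1 : derivAt (f ^ m) (g p) ∘L derivAt g p = derivAt g p ∘L derivAt (f ^ m) p := by
    have h2 := derivAt_mul g (f ^ m) p
    rw [pow_minimalPeriod_apply] at h2
    rw [← derivAt_mul, (h.pow_left m).eq, h2]
  have h3 : (derivAt (f ^ m) (g p)).toLinearMap = B.conj (derivAt (f ^ m) p).toLinearMap := by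
    refine LinearMap.ext fun v => ?_
    obtain ⟨w, rfl⟩ := B.surjective v
    rw [LinearEquiv.conj_apply_apply, B.symm_apply_apply]
    exact DFunLike.congr_fun h1 w
  have h4 : (returnDeriv f (g p)).toLinearMap.charpoly = (returnDeriv f p).toLinearMap.charpoly := by
    change (derivAt (f ^ Function.minimalPeriod f (g p)) (g p)).toLinearMap.charpoly
      = (derivAt (f ^ m) p).toLinearMap.charpoly
    rw [minimalPeriod_apply_of_commute h, ← hm, h3, LinearEquiv.charpoly_conj]
  simp only [eigenvaluesAt, h4]

theorem self_mem_orbit (f : Diff1 d M) (x : M) : x ∈ orbit f x := ⟨0, rfl⟩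

/-- When periodic points with distinct orbits have distinct eigenvalues, every periodic orbit is
preserved by the centralizer. -/
theorem apply_mem_orbit_of_mem_periodicPts [Nontrivial (EuclideanSpace ℝ (Fin d))]
    (distinct : HasDistinctEigenvalues f) (h : Commute f g) (hp : p ∈ Function.periodicPts f) :
    g p ∈ orbit f p := by
  by_contra hne
  have hdisj := distinct p hp (g p) ((apply_mem_periodicPts_iff h).2 hp) fun he =>
    hne (he ▸ self_mem_orbit f (g p))
  rw [eigenvaluesAt_apply_of_commute h, disjoint_self] at hdisj
  exact (eigenvaluesAt_nonempty f p).ne_empty hdisj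

theorem apply_mem_orbit_of_mem_orbit (h : Commute f g) (hp : g p ∈ orbit f p)
    (hx : x ∈ orbit f p) : g x ∈ orbit f p := by
  obtain ⟨k, hk⟩ := hp
  obtain ⟨j, rfl⟩ := hx
  refine ⟨j + k, ?_⟩
  change (f ^ (j + k)) p = g ((f ^ j) p)
  rw [zpow_add_apply, ← commute_apply (h.zpow_left j)]
  exact congrArg _ hk

theorem inv_apply_mem_orbit (h : Commute f g) (hp : g p ∈ orbit f p) : g⁻¹ p ∈ orbit f p := by
  obtain ⟨k, hk⟩ := hp
  refine ⟨-k, ?_⟩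
  replace hk : (f ^ k) p = g p := hk
  change (f ^ (-k)) p = g⁻¹ p
  rw [← zpow_neg_apply_zpow_apply f k (g⁻¹ p), commute_apply (h.inv_right.zpow_left k), hk,
    inv_apply_self]

theorem apply_mem_nonwanderingSet (h : Commute f g) (hx : x ∈ nonwanderingSet f) :
    g x ∈ nonwanderingSet f := by
  intro U hU
  obtain ⟨k, hk, _, hz, w, hw, rfl⟩ := hx (g ⁻¹' U) (g.continuous.continuousAt.preimage_mem_nhds hU)
  exact ⟨k, hk, g ((f ^ k) w), hz, g w, hw, commute_apply (h.pow_left k) w⟩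

theorem apply_mem_compl_nonwanderingSet (h : Commute f g) (hx : x ∈ (nonwanderingSet f)ᶜ) :
    g x ∈ (nonwanderingSet f)ᶜ := fun hgx => hx <| by
  simpa only [inv_apply_self] using apply_mem_nonwanderingSet h.inv_right hgx

theorem isClosed_nonwanderingSet (f : Diff1 d M) : IsClosed (nonwanderingSet f) := by
  rw [← isOpen_compl_iff, isOpen_iff_mem_nhds]
  intro x hx
  simp only [nonwanderingSet, mem_compl_iff, mem_ofPred_eq, not_forall] at hx
  obtain ⟨U, hU, hU'⟩ := hx
  filter_upwards [eventually_mem_nhds_iff.2 hU] with y hy hyΩ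
  exact hU' (hyΩ U hy)

/-- If `g` preserves a dense set of wandering orbits then it locally is an iterate of `f` near each
of them. -/
theorem exists_mem_interior_of_wandering [T2Space M] {X : Set M}
    (hX : (nonwanderingSet f)ᶜ ⊆ closure X) (hgX : ∀ x ∈ X, g x ∈ orbit f x) (hx : x ∈ X)
    (hxΩ : x ∈ (nonwanderingSet f)ᶜ) : ∃ k : ℤ, x ∈ interior {y | g y = (f ^ k) y} := by
  obtain ⟨k, hk⟩ := hgX x hx
  refine ⟨k, ?_⟩
  have hxΩ' := hxΩ
  simp only [nonwanderingSet, mem_compl_iff, mem_ofPred_eq, not_forall] at hxΩ'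
  obtain ⟨U, hU, hU'⟩ := hxΩ'
  have hdisj : ∀ n : ℕ, 0 < n → ∀ y ∈ U, (f ^ n) y ∉ U := fun n hn y hy hfy =>
    hU' ⟨n, hn, _, hfy, y, hy, rfl⟩
  let φ : Diff1 d M := f ^ (-k) * g
  have hφ : φ x = x := by
    change (f ^ (-k)) (g x) = x
    rw [← hk]
    exact zpow_neg_apply_zpow_apply f k x
  let V := interior U ∩ φ ⁻¹' interior U ∩ (nonwanderingSet f)ᶜ
  have hV : IsOpen V := (isOpen_interior.inter (isOpen_interior.preimage φ.continuous)).inter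
    (isClosed_nonwanderingSet f).isOpen_compl
  have hxU := mem_interior_iff_mem_nhds.2 hU
  have hxV : x ∈ V := ⟨⟨hxU, by rwa [mem_preimage, hφ]⟩, hxΩ⟩
  have hVX : V ∩ X ⊆ {y | g y = (f ^ k) y} := by
    rintro y ⟨⟨⟨hyU, hyφ⟩, -⟩, hyX⟩
    obtain ⟨j, hj⟩ := hgX y hyX
    replace hj : (f ^ j) y = g y := hj
    -- Both `y` and `f ^ (j - k) y` lie in `U`, which meets none of its positive iterates; hence `j
    -- = k`.
    have h1 : (f ^ (j - k)) y ∈ U := by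
      have h2 : φ y ∈ U := interior_subset hyφ
      have h3 : φ y = (f ^ (j - k)) y := by
        change (f ^ (-k)) (g y) = _
        rw [← hj, ← zpow_add_apply]
        congr 2
        ring
      rwa [h3] at h2
    obtain ⟨n, hn | hn⟩ := (j - k).eq_nat_or_neg
    · rcases n.eq_zero_or_pos with rfl | hn0
      · have : j = k := by simpa [sub_eq_zero] using hn
        rw [mem_ofPred_eq, ← hj, this]
      · rw [hn, zpow_natCast] at h1
        exact absurd h1 (hdisj n hn0 y (interior_subset hyU))
    · rcases n.eq_zero_or_pos with rfl | hn0
      · have : j = k := by simpa [sub_eq_zero] using hn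
        rw [mem_ofPred_eq, ← hj, this]
      · refine absurd ?_ (hdisj n hn0 _ h1)
        rw [hn, ← zpow_natCast, zpow_apply_zpow_neg_apply]
        exact interior_subset hyU
  refine mem_interior.2 ⟨V, fun y hy => ?_, hV, hxV⟩
  have hcl : IsClosed {y | g y = (f ^ k) y} := isClosed_eq g.continuous (f ^ k).continuous
  exact closure_minimal hVX hcl (hV.inter_closure ⟨hy, hX hy.2⟩)

theorem eq_zpow_apply_zpow_iff (h : Commute f g) (j k : ℤ) (x : M) :
    g ((f ^ j) x) = (f ^ k) ((f ^ j) x) ↔ g x = (f ^ k) x := by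
  rw [← commute_apply (h.zpow_left j), commute_apply (((Commute.refl f).zpow_left k).zpow_right j)]
  exact (f ^ j).injective.eq_iff

theorem zpow_apply_mem_interior (h : Commute f g) {k : ℤ} (j : ℤ)
    (hx : x ∈ interior {y | g y = (f ^ k) y}) :
    (f ^ j) x ∈ interior {y | g y = (f ^ k) y} := by
  rw [mem_interior_iff_mem_nhds] at hx ⊢
  have h1 : x = (f ^ (-j)) ((f ^ j) x) := (zpow_neg_apply_zpow_apply f j x).symm
  rw [h1] at hx
  filter_upwards [(f ^ (-j)).continuous.continuousAt.preimage_mem_nhds hx] with y hy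
  exact (eq_zpow_apply_zpow_iff h (-j) k y).1 hy

/-- By Baire, it suffices that each fixed set of `f ^ (n + 1)` has empty interior; at an interior
point the derivative would be the identity. -/
theorem dense_compl_periodicPts [T2Space M] [BaireSpace M]
    [Nontrivial (EuclideanSpace ℝ (Fin d))]
    (hyp : ∀ p ∈ Function.periodicPts f, IsHyperbolicPeriodic f p) :
    Dense (Function.periodicPts f)ᶜ := by
  have h1 : (Function.periodicPts f)ᶜ = ⋂ n : ℕ, {x | (f ^ (n + 1)) x = x}ᶜ := by
    ext x
    simp only [mem_compl_iff, mem_iInter, mem_ofPred_eq, Function.mem_periodicPts, not_exists,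
      not_and, isPeriodicPt_iff]
    exact ⟨fun h n => h (n + 1) n.succ_pos, fun h n hn => by
      obtain ⟨m, rfl⟩ := Nat.exists_eq_succ_of_ne_zero hn.ne'
      exact h m⟩
  rw [h1]
  refine dense_iInter_of_isOpen_nat (fun n => ?_) fun n => ?_
  · exact (isClosed_eq (f ^ (n + 1)).continuous continuous_id).isOpen_compl
  · rw [← interior_eq_empty_iff_dense_compl, eq_empty_iff_forall_notMem]
    intro x hx
    have hfix : (f ^ ((n + 1 : ℕ) : ℤ)) x = x := by
      rw [zpow_natCast]
      exact interior_subset (s := {x | (f ^ (n + 1)) x = x}) hx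
    have hn : ((n + 1 : ℕ) : ℤ) ≠ 0 := by positivity
    have hper := mem_periodicPts_of_zpow_apply hn hfix
    obtain ⟨v, hv⟩ := exists_ne (0 : EuclideanSpace ℝ (Fin d))
    refine (hyp x hper).derivAt_zpow_apply_ne hn hfix hv ?_
    have h2 : derivAt (f ^ ((n + 1 : ℕ) : ℤ)) x = derivAt 1 x := by
      refine derivAt_eq_of_eventuallyEq ?_
      rw [zpow_natCast]
      exact mem_interior_iff_mem_nhds.1 hx
    rw [h2, derivAt_one]
    rfl

end Dynamics

/-! ### Stable manifolds under commuting diffeomorphisms -/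

section StableManifolds

variable {d : ℕ} {M : Type*} [MetricSpace M] [CompactSpace M]
  [ChartedSpace (EuclideanSpace ℝ (Fin d)) M] {f g : Diff1 d M} {p x : M}

theorem uniformContinuous_diff (φ : Diff1 d M) : UniformContinuous φ :=
  CompactSpace.uniformContinuous_of_continuous φ.continuous

theorem apply_mem_stableManifold (h : Commute f g) (hx : x ∈ stableManifold f p) :
    g x ∈ stableManifold f (g p) := by
  have h1 : Tendsto (fun n : ℕ => ((f ^ n) x, (f ^ n) p)) atTop (uniformity M) :=
    tendsto_uniformity_iff_dist_tendsto_zero.2 hx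
  have h2 := tendsto_uniformity_iff_dist_tendsto_zero.1 (Tendsto.comp (uniformContinuous_diff g) h1)
  refine h2.congr fun n => ?_
  simp only [Function.comp_apply, commute_apply (h.pow_left n)]

theorem apply_mem_orbitStableManifold (h : Commute f g) (hp : g p ∈ orbit f p)
    (hx : x ∈ orbitStableManifold f p) : g x ∈ orbitStableManifold f p := by
  obtain ⟨q, hq, hxq⟩ := mem_iUnion₂.1 hx
  exact mem_iUnion₂.2 ⟨g q, apply_mem_orbit_of_mem_orbit h hp hq, apply_mem_stableManifold h hxq⟩

/-- Composition with `g` preserves the generating curves: uniform continuity of `g` keeps forward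
orbits uniformly close. -/
theorem mfderiv_apply_mem_stableTangentSpace (h : Commute f g) (hp : g p ∈ orbit f p)
    {v : TangentSpace (𝓡 d) x} (hv : v ∈ stableTangentSpace f p x) :
    mfderiv (𝓡 d) (𝓡 d) g x v ∈ stableTangentSpace f p (g x) := by
  have hle : stableTangentSpace f p x ≤
      (stableTangentSpace f p (g x)).comap (mfderiv (𝓡 d) (𝓡 d) g x).toLinearMap := by
    refine Submodule.span_le.2 ?_
    rintro v ⟨γ, hγ, hγW, hγu, hγv⟩
    refine Submodule.subset_span ⟨g ∘ γ, g.contMDiff.comp hγ,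
      fun t => apply_mem_orbitStableManifold h hp (hγW t), fun t => ?_, ?_⟩
    · simp only [Function.comp_apply, commute_apply (h.pow_left _)]
      exact (uniformContinuous_diff g).comp_tendstoUniformly (hγu t)
    · rw [tangentMap_comp_at _ (mdifferentiableAt_diff g _)
        (hγ.mdifferentiable one_ne_zero _), hγv]
      rfl
  exact hle hv

/-- On the orbits which `g` preserves in the stable manifold of a hyperbolic periodic orbit, `g`
agrees with one of finitely many iterates of `f`. -/
theorem IsHyperbolicPeriodic.exists_finset_exponents (hyp : IsHyperbolicPeriodic f p)
    (h : Commute f g) (hp : g p ∈ orbit f p) :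
    ∃ K : Finset ℤ, ∀ x ∈ orbitStableManifold f p, g x ∈ orbit f x →
      ∃ k ∈ K, g x = (f ^ k) x := by
  obtain ⟨k₀, hk₀⟩ := hp
  replace hk₀ : (f ^ k₀) p = g p := hk₀
  -- The extra exponent `k₀` serves the points of the periodic orbit itself, where no coincidences
  -- need accumulate.
  refine ⟨insert k₀ (hyp.finite_exponents h).toFinset, fun x hx hgx => ?_⟩
  obtain ⟨k, hk⟩ := hgx
  replace hk : g x = (f ^ k) x := hk.symm
  obtain ⟨_, ⟨j, rfl⟩, hxq⟩ := mem_iUnion₂.1 hx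
  have hself := apply_mem_stableManifold ((Commute.refl f).zpow_right (-j)) hxq
  simp only [zpow_neg_apply_zpow_apply] at hself
  obtain ⟨y, rfl⟩ : ∃ y, (f ^ j) y = x := ⟨_, zpow_apply_zpow_neg_apply f j x⟩
  rw [zpow_neg_apply_zpow_apply] at hself
  rw [eq_zpow_apply_zpow_iff h] at hk
  simp only [eq_zpow_apply_zpow_iff h]
  rcases eq_or_ne y p with rfl | hyp'
  · exact ⟨k₀, Finset.mem_insert_self _ _, hk₀.symm⟩
  refine ⟨k, Finset.mem_insert_of_mem ((hyp.finite_exponents h).mem_toFinset.2 ?_), hk⟩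
  set m := Function.minimalPeriod f p with hm
  have hm0 : 0 < m := Function.minimalPeriod_pos_iff_mem_periodicPts.2 hyp.1
  have hfix : ∀ n : ℕ, (f ^ (m * n)) p = p := fun n =>
    isPeriodicPt_iff.1 ((Function.isPeriodicPt_minimalPeriod f p).mul_const n)
  -- Iterating by multiples of the period keeps `p` fixed, so the orbit of `y` supplies coincidence
  -- points converging to `p` and distinct from it.
  have hlim : Tendsto (fun n : ℕ => (f ^ (m * n)) y) atTop (𝓝 p) := by
    rw [tendsto_iff_dist_tendsto_zero]
    have h1 : Tendsto (fun n : ℕ => m * n) atTop atTop :=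
      tendsto_id.const_mul_atTop' hm0
    refine (Tendsto.comp (show Tendsto _ _ _ from hself) h1).congr fun n => ?_
    simp only [Function.comp_apply, hfix]
  have hne : ∀ n : ℕ, (f ^ (m * n)) y ≠ p := fun n hn =>
    hyp' ((f ^ (m * n)).injective (hn.trans (hfix n).symm))
  have hcoin : ∀ n : ℕ, g ((f ^ (m * n)) y) = (f ^ k) ((f ^ (m * n)) y) := fun n => by
    rw [← zpow_natCast, eq_zpow_apply_zpow_iff h]
    exact hk
  have hgp : g p = (f ^ k) p :=
    (isClosed_eq g.continuous (f ^ k).continuous).mem_of_tendsto hlim (Eventually.of_forall hcoin)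
  refine ⟨hgp, exists_derivAt_apply_eq hgp ?_⟩
  have hlim' : Tendsto (fun n : ℕ => (f ^ (m * n)) y) atTop (𝓝[≠] p) :=
    tendsto_nhdsWithin_iff.2 ⟨hlim, Eventually.of_forall hne⟩
  exact hlim'.frequently (Eventually.of_forall hcoin).frequently

end StableManifolds

/-! ### Bounded distortion and bounded exponents -/

section Distortion

variable {d : ℕ} {M : Type*} [MetricSpace M] [CompactSpace M]
  [ChartedSpace (EuclideanSpace ℝ (Fin d)) M] [IsManifold (𝓡 d) 1 M]
  [RiemannianBundle (fun x : M => TangentSpace (𝓡 d) x)]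
  [IsContinuousRiemannianBundle (EuclideanSpace ℝ (Fin d))
    (fun x : M => TangentSpace (𝓡 d) x)] {f g : Diff1 d M} {p x : M}

/-- A common bound for the derivatives of `g` and of its inverse. -/
theorem exists_derivative_bounds (g : Diff1 d M) : ∃ C : ℝ, 1 ≤ C ∧
    (∀ (x : M) (v : TangentSpace (𝓡 d) x), ‖mfderiv (𝓡 d) (𝓡 d) g x v‖ ≤ C * ‖v‖) ∧
    (∀ (x : M) (v : TangentSpace (𝓡 d) x), ‖mfderiv (𝓡 d) (𝓡 d) ⇑g⁻¹ x v‖ ≤ C * ‖v‖) := by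
  obtain ⟨C₁, h₁, hC₁⟩ := exists_norm_mfderiv_apply_le g
  obtain ⟨C₂, -, hC₂⟩ := exists_norm_mfderiv_apply_le g⁻¹
  exact ⟨max C₁ C₂, h₁.trans (le_max_left _ _),
    fun x v => (hC₁ x v).trans (mul_le_mul_of_nonneg_right (le_max_left _ _) (norm_nonneg v)),
    fun x v => (hC₂ x v).trans (mul_le_mul_of_nonneg_right (le_max_right _ _) (norm_nonneg v))⟩

theorem exists_abs_log_absDet_sub_le (h : Commute f g) : ∃ K > (0 : ℝ), ∀ (x : M) (n : ℕ),
    |Real.log (absDet f n x) - Real.log (absDet f n (g x))| ≤ K := by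
  obtain ⟨C, hC, hg, hg'⟩ := exists_derivative_bounds g
  -- The maximum with `1` makes the constant positive, as the distortion hypotheses require.
  refine ⟨max 1 (2 * Real.log (detBound d C)), lt_max_of_lt_left one_pos, fun x n =>
    le_trans ?_ (le_max_right _ _)⟩
  refine abs_log_normDet_sub_le (A₁ := (mfderiv (𝓡 d) (𝓡 d) ⇑(f ^ n) x).toLinearMap)
    (A₂ := (mfderiv (𝓡 d) (𝓡 d) ⇑(f ^ n) (g x)).toLinearMap)
    (G := (mfderiv (𝓡 d) (𝓡 d) g x).toLinearMap)
    (H := (mfderiv (𝓡 d) (𝓡 d) g ((f ^ n) x)).toLinearMap) hC (hg x)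
    (norm_le_norm_mfderiv_apply hg' x) (hg _) (norm_le_norm_mfderiv_apply hg' _)
    (derivAt_injective (f ^ n) x) (derivAt_injective (f ^ n) (g x)) rfl
    (finrank_euclideanSpace_fin (𝕜 := ℝ) (n := d)).le ?_
  have h1 : (⇑g ∘ ⇑(f ^ n)) = ⇑(f ^ n) ∘ ⇑g :=
    funext fun y => (commute_apply (h.pow_left n) y).symm
  have h2 := congrArg (fun φ : M → M => (mfderiv (𝓡 d) (𝓡 d) φ x).toLinearMap.normDet) h1
  rw [mfderiv_comp x (mdifferentiableAt_diff g _) (mdifferentiableAt_diff (f ^ n) x),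
    mfderiv_comp x (mdifferentiableAt_diff (f ^ n) _) (mdifferentiableAt_diff g x)] at h2
  exact h2

theorem exists_abs_log_absDetStable_sub_le (h : Commute f g) (hp : g p ∈ orbit f p) :
    ∃ K > (0 : ℝ), ∀ (x : M) (n : ℕ),
      |Real.log (absDetStable f p n x) - Real.log (absDetStable f p n (g x))| ≤ K := by
  obtain ⟨C, hC, hg, hg'⟩ := exists_derivative_bounds g
  refine ⟨max 1 (2 * Real.log (detBound d C)), lt_max_of_lt_left one_pos, fun x n =>
    le_trans ?_ (le_max_right _ _)⟩
  -- Used for `g` and for `g⁻¹`, this gives equality of the dimensions at `x` and `g x`.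
  have hle : ∀ {φ : Diff1 d M} (_ : Commute f φ) (_ : φ p ∈ orbit f p) (y : M),
      Module.finrank ℝ (stableTangentSpace f p y)
        ≤ Module.finrank ℝ (stableTangentSpace f p (φ y)) := by
    intro φ hφ hφp y
    refine LinearMap.finrank_le_finrank_of_injective
      (f := (mfderiv (𝓡 d) (𝓡 d) φ y).toLinearMap.restrict
        fun v hv => mfderiv_apply_mem_stableTangentSpace hφ hφp hv) fun v w hvw => ?_
    exact Subtype.ext (derivAt_injective φ y (congrArg Subtype.val hvw))
  have hdim : Module.finrank ℝ (stableTangentSpace f p x)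
      = Module.finrank ℝ (stableTangentSpace f p (g x)) := by
    refine le_antisymm (hle h hp x) ?_
    have := hle h.inv_right (inv_apply_mem_orbit h hp) (g x)
    rwa [inv_apply_self] at this
  refine abs_log_normDet_sub_le
    (A₁ := (mfderiv (𝓡 d) (𝓡 d) ⇑(f ^ n) x).toLinearMap ∘ₗ (stableTangentSpace f p x).subtype)
    (A₂ := (mfderiv (𝓡 d) (𝓡 d) ⇑(f ^ n) (g x)).toLinearMap ∘ₗ
      (stableTangentSpace f p (g x)).subtype)
    (G := (mfderiv (𝓡 d) (𝓡 d) g x).toLinearMap.restrict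
      fun v hv => mfderiv_apply_mem_stableTangentSpace h hp hv)
    (H := (mfderiv (𝓡 d) (𝓡 d) g ((f ^ n) x)).toLinearMap) hC (fun v => hg x v)
    (fun v => norm_le_norm_mfderiv_apply hg' x v) (hg _) (norm_le_norm_mfderiv_apply hg' _)
    (fun v w hvw => Subtype.ext (derivAt_injective (f ^ n) x hvw))
    (fun v w hvw => Subtype.ext (derivAt_injective (f ^ n) (g x) hvw)) hdim
    ((Submodule.finrank_le _).trans (finrank_euclideanSpace_fin (𝕜 := ℝ) (n := d)).le) ?_
  have h1 : (⇑g ∘ ⇑(f ^ n)) = ⇑(f ^ n) ∘ ⇑g :=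
    funext fun y => (commute_apply (h.pow_left n) y).symm
  have h2 := congrArg (fun φ : M → M => ((mfderiv (𝓡 d) (𝓡 d) φ x).toLinearMap ∘ₗ
    (stableTangentSpace f p x).subtype).normDet) h1
  rw [mfderiv_comp x (mdifferentiableAt_diff g _) (mdifferentiableAt_diff (f ^ n) x),
    mfderiv_comp x (mdifferentiableAt_diff (f ^ n) _) (mdifferentiableAt_diff g x)] at h2
  exact h2

/-- Under the large derivative property, a diffeomorphism commuting with `f` which coincides with
an iterate `f ^ k` near a nonperiodic point forces `|k|` to be bounded. -/
theorem LargeDerivativeOn.exists_bound (ld : LargeDerivativeOn f (Function.periodicPts f)ᶜ)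
    (h : Commute f g) : ∃ N : ℕ, ∀ (k : ℤ) (x : M), x ∈ (Function.periodicPts f)ᶜ →
      x ∈ interior {y | g y = (f ^ k) y} → k ∈ Finset.Icc (-(N : ℤ)) N := by
  obtain ⟨C, hC, hg, hg'⟩ := exists_derivative_bounds g
  obtain ⟨N, -, hN⟩ := ld C (zero_lt_one.trans_le hC)
  have key : ∀ φ : Diff1 d M, Commute f φ →
      (∀ (x : M) (v : TangentSpace (𝓡 d) x), ‖mfderiv (𝓡 d) (𝓡 d) φ x v‖ ≤ C * ‖v‖) →
      (∀ (x : M) (v : TangentSpace (𝓡 d) x), ‖mfderiv (𝓡 d) (𝓡 d) ⇑φ⁻¹ x v‖ ≤ C * ‖v‖) →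
      ∀ (n : ℕ) (x : M), x ∈ (Function.periodicPts f)ᶜ →
        x ∈ interior {y | φ y = (f ^ (n : ℤ)) y} → n < N := by
    intro φ hφ hb hb' n x hx hxn
    by_contra! hn
    obtain ⟨j, hj⟩ := hN x hx n hn
    -- The coincidence propagates along the whole orbit of `x`, so both norms in the hypothesis are
    -- bounded by `C` for every `j`.
    have hy := mem_interior_iff_mem_nhds.1 (zpow_apply_mem_interior hφ j hxn)
    have h1 : ‖mfderiv (𝓡 d) (𝓡 d) ⇑(f ^ n) ((f ^ j) x)‖ ≤ C := by
      refine norm_mfderiv_le_of_eventuallyEq hC hb ?_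
      filter_upwards [hy] with z hz
      rw [← zpow_natCast]
      exact Eq.symm hz
    have h2 : ‖mfderiv (𝓡 d) (𝓡 d) ⇑(f ^ (-(n : ℤ))) ((f ^ (j + n)) x)‖ ≤ C := by
      refine norm_mfderiv_le_of_eventuallyEq hC hb' ?_
      have hyn : (f ^ j) x ∈ {y | φ y = (f ^ (n : ℤ)) y} := mem_of_mem_nhds hy
      have h3 : φ⁻¹ ((f ^ (j + n)) x) = (f ^ j) x := by
        rw [add_comm, zpow_add_apply, ← show φ ((f ^ j) x) = (f ^ (n : ℤ)) ((f ^ j) x) from hyn,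
          inv_apply_self]
      rw [← h3] at hy
      filter_upwards [φ⁻¹.continuous.continuousAt.preimage_mem_nhds hy] with z hz
      have hz' : φ (φ⁻¹ z) = (f ^ (n : ℤ)) (φ⁻¹ z) := hz
      rw [apply_inv_self] at hz'
      conv_lhs => rw [hz', zpow_neg_apply_zpow_apply]
    exact hj.not_ge (max_le h1 h2)
  refine ⟨N, fun k x hx hxk => ?_⟩
  obtain ⟨n, rfl | rfl⟩ := k.eq_nat_or_neg
  · have := key g h hg hg' n x hx hxk
    rw [Finset.mem_Icc]
    omega
  -- For a negative exponent, `g⁻¹` coincides with `f ^ n` near `g x`.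
  · have hgx : g x ∈ interior {y | g⁻¹ y = (f ^ (n : ℤ)) y} := by
      rw [mem_interior_iff_mem_nhds] at hxk ⊢
      rw [← inv_apply_self g x] at hxk
      filter_upwards [g⁻¹.continuous.continuousAt.preimage_mem_nhds hxk] with z hz
      have hz' : g (g⁻¹ z) = (f ^ (-(n : ℤ))) (g⁻¹ z) := hz
      rw [apply_inv_self] at hz'
      conv_rhs => rw [hz', zpow_apply_zpow_neg_apply]
    have := key g⁻¹ h.inv_right hg' (by rw [inv_inv]; exact hg) n (g x)
      (fun hper => hx ((apply_mem_periodicPts_iff h).1 hper)) hgx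
    rw [Finset.mem_Icc]
    omega

end Distortion

/-! ### Finite closed covers -/

section Gluing

/-- A nonempty open set covered by finitely many closed sets meets the interior of one of them. -/
theorem exists_nonempty_interior_inter_of_subset_biUnion {X ι : Type*} [TopologicalSpace X]
    {P : ι → Set X} (hP : ∀ i, IsClosed (P i)) (K : Finset ι) :
    ∀ V : Set X, IsOpen V → V.Nonempty → V ⊆ ⋃ i ∈ K, P i → ∃ i, (V ∩ interior (P i)).Nonempty := by
  classical
  induction K using Finset.induction_on with
  | empty =>
    rintro V - ⟨x, hx⟩ hsub
    simpa using hsub hx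
  | insert i K _ ih =>
    intro V hV hne hsub
    by_cases hVi : V ⊆ P i
    · exact ⟨i, by rwa [inter_eq_self_of_subset_left (hV.subset_interior_iff.2 hVi)]⟩
    · obtain ⟨x, hxV, hx⟩ := not_subset.1 hVi
      obtain ⟨k, y, hy, hyk⟩ := ih (V \ P i) (hV.sdiff (hP i)) ⟨x, hxV, hx⟩ fun y hy => by
        have := hsub hy.1
        rw [Finset.set_biUnion_insert] at this
        exact this.resolve_left hy.2
      exact ⟨k, y, hy.1, hyk⟩

/-- A connected space is not a finite union of two or more nonempty disjoint closed sets. -/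
theorem exists_eq_univ_of_finite_closed_cover {X ι : Type*} [TopologicalSpace X]
    [ConnectedSpace X] {Q : ι → Set X} (hQ : ∀ i, IsClosed (Q i)) {K : Finset ι}
    (hcover : ⋃ i ∈ K, Q i = univ) (hdisj : Pairwise (Function.onFun Disjoint Q)) :
    ∃ i, Q i = univ := by
  classical
  obtain ⟨x⟩ := (inferInstance : Nonempty X)
  obtain ⟨i, hi, hx⟩ := mem_iUnion₂.1 (hcover.symm ▸ mem_univ x)
  refine ⟨i, IsClopen.eq_univ ⟨hQ i, ?_⟩ ⟨x, hx⟩⟩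
  have hcompl : (Q i)ᶜ = ⋃ j ∈ K.erase i, Q j := by
    ext y
    simp only [mem_compl_iff, mem_iUnion, Finset.mem_erase, exists_prop]
    constructor
    · intro hy
      obtain ⟨j, hj, hyj⟩ := mem_iUnion₂.1 (hcover.symm ▸ mem_univ y)
      exact ⟨j, ⟨fun he => hy (he ▸ hyj), hj⟩, hyj⟩
    · rintro ⟨j, ⟨hji, -⟩, hyj⟩ hyi
      exact disjoint_left.1 (hdisj hji) hyj hyi
  rw [← isClosed_compl_iff, hcompl]
  exact isClosed_biUnion_finset fun j _ => hQ j

end Gluing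

/-! ### Proof of the theorem in positive dimension -/

section Main

variable {d : ℕ} {M : Type*} [MetricSpace M] [CompactSpace M]
  [ChartedSpace (EuclideanSpace ℝ (Fin d)) M] [IsManifold (𝓡 d) 1 M]
  [RiemannianBundle (fun x : M => TangentSpace (𝓡 d) x)]
  [IsContinuousRiemannianBundle (EuclideanSpace ℝ (Fin d))
    (fun x : M => TangentSpace (𝓡 d) x)] {f g : Diff1 d M} {p : M}

theorem UDWandering.exists_interior_inter (udw : UDWandering f) (h : Commute f g) {V : Set M}
    (hV : IsOpen V) (hVne : (V ∩ (nonwanderingSet f)ᶜ).Nonempty) :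
    ∃ k : ℤ, (V ∩ interior {y | g y = (f ^ k) y}).Nonempty := by
  obtain ⟨X, hXΩ, hX, hud⟩ := udw
  obtain ⟨K, hK, hbound⟩ := exists_abs_log_absDet_sub_le h
  have hgX : ∀ x ∈ X, g x ∈ orbit f x := by
    intro x hx
    by_contra hgx
    obtain ⟨n, -, hn⟩ := hud K hK x hx (g x) (apply_mem_compl_nonwanderingSet h (hXΩ hx)) hgx
    exact hn.not_ge (hbound x n)
  obtain ⟨y, hyV, hyΩ⟩ := hVne
  obtain ⟨x, hxV, hxX⟩ := mem_closure_iff.1 (hX hyΩ) V hV hyV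
  obtain ⟨k, hk⟩ := exists_mem_interior_of_wandering hX hgX hxX (hXΩ hxX)
  exact ⟨k, x, hxV, hk⟩

/-- Finiteness of the set of exponents makes the union closed, so the inclusion passes from the
dense set of unbounded distortion to the closure. -/
theorem UDStable.closure_subset (uds : UDStable f) (hyp : IsHyperbolicPeriodic f p)
    (h : Commute f g) (hp : g p ∈ orbit f p) :
    ∃ K : Finset ℤ, closure (stableManifold f p) ⊆ ⋃ k ∈ K, {y | g y = (f ^ k) y} := by
  obtain ⟨X, hXW, hX, hud⟩ := uds p hyp
  obtain ⟨B, hB, hbound⟩ := exists_abs_log_absDetStable_sub_le h hp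
  obtain ⟨K, hK⟩ := hyp.exists_finset_exponents h hp
  have hclosed : IsClosed (⋃ k ∈ K, {y | g y = (f ^ k) y}) :=
    isClosed_biUnion_finset fun k _ => isClosed_eq g.continuous (f ^ k).continuous
  refine ⟨K, closure_minimal ?_ hclosed⟩
  have h1 : stableManifold f p ⊆ closure X := fun x hx =>
    hX (mem_iUnion₂.2 ⟨p, self_mem_orbit f p, hx⟩)
  refine h1.trans (closure_minimal (fun x hx => ?_) hclosed)
  have hgx : g x ∈ orbit f x := by
    by_contra hgx
    obtain ⟨n, -, hn⟩ := hud B hB x hx (g x) (apply_mem_orbitStableManifold h hp (hXW hx)) hgx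
    exact hn.not_ge (hbound x n)
  obtain ⟨k, hk, hgk⟩ := hK x (hXW hx) hgx
  exact mem_iUnion₂.2 ⟨k, hk, hgk⟩

theorem exists_eq_zpow_of_commute [ConnectedSpace M] [Nontrivial (EuclideanSpace ℝ (Fin d))]
    (hyp : ∀ p ∈ Function.periodicPts f, IsHyperbolicPeriodic f p)
    (distinct : HasDistinctEigenvalues f) (comp : InteriorComponentsHaveDenseStable f)
    (udw : UDWandering f) (uds : UDStable f)
    (ld : LargeDerivativeOn f (Function.periodicPts f)ᶜ) (h : Commute f g) :
    ∃ k : ℤ, f ^ k = g := by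
  have : LocallyConnectedSpace M := ChartedSpace.locallyConnectedSpace (EuclideanSpace ℝ (Fin d)) M
  let P : ℤ → Set M := fun k => {y | g y = (f ^ k) y}
  have hP : ∀ k, IsClosed (P k) := fun k => isClosed_eq g.continuous (f ^ k).continuous
  have hmeet : ∀ V : Set M, IsOpen V → V.Nonempty → ∃ k, (V ∩ interior (P k)).Nonempty := by
    intro V hV hne
    by_cases hVΩ : (V ∩ (nonwanderingSet f)ᶜ).Nonempty
    · exact udw.exists_interior_inter h hV hVΩ
    · obtain ⟨x, hx⟩ := hne
      have hVint : V ⊆ interior (nonwanderingSet f) := hV.subset_interior_iff.2 fun y hy => by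
        by_contra hyΩ
        exact hVΩ ⟨y, hy, hyΩ⟩
      obtain ⟨p, -, hp, hsub⟩ := comp x (hVint hx)
      obtain ⟨K, hK⟩ := uds.closure_subset (hyp p hp) h
        (apply_mem_orbit_of_mem_periodicPts distinct h hp)
      obtain ⟨k, y, hy, hyk⟩ := exists_nonempty_interior_inter_of_subset_biUnion hP K
        (V ∩ connectedComponentIn (interior (nonwanderingSet f)) x)
        (hV.inter isOpen_interior.connectedComponentIn)
        ⟨x, hx, mem_connectedComponentIn (hVint hx)⟩
        (inter_subset_right.trans (hsub.trans hK))
      exact ⟨k, y, hy.1, hyk⟩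
  obtain ⟨N, hN⟩ := ld.exists_bound h
  have hbound : ∀ k, (interior (P k)).Nonempty → k ∈ Finset.Icc (-(N : ℤ)) N := by
    intro k hk
    -- Large derivative concerns nonperiodic points only; their density puts one in the interior.
    obtain ⟨x, hxk, hx⟩ := (dense_compl_periodicPts hyp).inter_open_nonempty _ isOpen_interior hk
    exact hN k x hx hxk
  have hcover : ⋃ k ∈ Finset.Icc (-(N : ℤ)) N, closure (interior (P k)) = univ := by
    rw [← (Finset.Icc (-(N : ℤ)) N).closure_biUnion]
    refine dense_iff_closure_eq.1 (dense_iff_inter_open.2 fun V hV hne => ?_)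
    obtain ⟨k, x, hxV, hxk⟩ := hmeet V hV hne
    exact ⟨x, hxV, mem_iUnion₂.2 ⟨k, hbound k ⟨x, hxk⟩, hxk⟩⟩
  have hsub : ∀ k, closure (interior (P k)) ⊆ P k := fun k =>
    (hP k).closure_subset_iff.2 interior_subset
  have hdisj : Pairwise (Function.onFun Disjoint fun k => closure (interior (P k))) := by
    intro k l hkl
    refine disjoint_left.2 fun x hxk hxl => ?_
    have hx : (f ^ k) x = (f ^ l) x := (show g x = _ from hsub k hxk).symm.trans (hsub l hxl)
    have hD : derivAt (f ^ k) x = derivAt (f ^ l) x :=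
      (derivAt_eq_of_mem_closure hxk).symm.trans (derivAt_eq_of_mem_closure hxl)
    have hfix : (f ^ (-l + k)) x = x := by
      rw [zpow_add_apply, hx, zpow_neg_apply_zpow_apply]
    have hne : -l + k ≠ 0 := by omega
    obtain ⟨v, hv⟩ := exists_ne (0 : EuclideanSpace ℝ (Fin d))
    refine (hyp x (mem_periodicPts_of_zpow_apply hne hfix)).derivAt_zpow_apply_ne hne hfix hv ?_
    have h1 : derivAt (f ^ (-l + k)) x = derivAt (f ^ (-l + l)) x := by
      rw [zpow_add, zpow_add, derivAt_mul, derivAt_mul, hD, hx]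
    rw [h1, neg_add_cancel, zpow_zero, derivAt_one]
    rfl
  obtain ⟨k, hk⟩ := exists_eq_univ_of_finite_closed_cover (fun k => isClosed_closure) hcover hdisj
  refine ⟨k, Diffeomorph.ext fun x => ?_⟩
  exact (show g x = _ from hsub k (hk.symm ▸ mem_univ x)).symm

end Main

end TrivialCentralizer

end

theorem mainTheorem8 (d : ℕ) (M : Type*) [MetricSpace M] [CompactSpace M] [ConnectedSpace M]
    [ChartedSpace (EuclideanSpace ℝ (Fin d)) M] [IsManifold (𝓡 d) ∞ M]
    [RiemannianBundle (fun x : M => TangentSpace (𝓡 d) x)]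
    [IsContMDiffRiemannianBundle (𝓡 d) ∞ (EuclideanSpace ℝ (Fin d))
      (fun x : M => TangentSpace (𝓡 d) x)]
    (f : TrivialCentralizer.Diff1 d M)
    (hyp : ∀ p ∈ Function.periodicPts f, TrivialCentralizer.IsHyperbolicPeriodic f p)
    (distinct : TrivialCentralizer.HasDistinctEigenvalues f)
    (comp : TrivialCentralizer.InteriorComponentsHaveDenseStable f)
    (udw : TrivialCentralizer.UDWandering f)
    (uds : TrivialCentralizer.UDStable f)
    (ld : TrivialCentralizer.LargeDerivativeOn f (Function.periodicPts f)ᶜ) :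
    Subgroup.centralizer {f} = Subgroup.zpowers f := by
  ext g
  rw [Subgroup.mem_centralizer_singleton_iff, Subgroup.mem_zpowers_iff]
  constructor
  · intro hg
    -- In dimension zero there are no eigenvalues to use, but `M` is discrete and connected, hence a
    -- point.
    rcases subsingleton_or_nontrivial (EuclideanSpace ℝ (Fin d)) with hd | hd
    · have : DiscreteTopology M := ChartedSpace.discreteTopology (EuclideanSpace ℝ (Fin d)) M
      have : Subsingleton M := PreconnectedSpace.trivial_of_discrete
      exact ⟨0, Diffeomorph.ext fun x => Subsingleton.elim _ _⟩
    · have : IsContinuousRiemannianBundle (EuclideanSpace ℝ (Fin d))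
          (fun x : M => TangentSpace (𝓡 d) x) := by
        obtain ⟨b, hb, hb'⟩ := IsContMDiffRiemannianBundle.exists_contMDiff (IB := 𝓡 d) (n := ∞)
          (F := EuclideanSpace ℝ (Fin d)) (E := fun x : M => TangentSpace (𝓡 d) x)
        exact ⟨b, hb.continuous, hb'⟩
      exact TrivialCentralizer.exists_eq_zpow_of_commute hyp distinct comp udw uds ld hg.symm
  · rintro ⟨k, rfl⟩
    exact ((Commute.refl f).zpow_left k).eq
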